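/- **Setting.** Let $(X,Y)\in\mathbb R^p\times\mathbb R$ satisfy $Y=X^T\beta^*+\epsilon$ with $\mathbb E[\epsilon\mid X]=0$ and $\mathrm{Var}[\epsilon\mid X]=\sigma^2$, where $\sigma>0$, and let $\Sigma=\mathbb E[XX^T]$. There are $K$ missingness patterns; in pattern $k$ the covariates indexed by a nonempty set $O_k\subseteq[p]$ are observed, and $M_k=[p]\setminus O_k$. The labelled data consist of independent data sets $\mathcal D_1,\dots,\mathcal D_K$, where $\mathcal D_k$ consists of $n_k$ i.i.d. copies of $(X_{O_k},Y)$. Put $$S_{M_k}=\Sigma_{M_kM_k}-\Sigma_{M_kO_k}\Sigma_{O_kO_k}^{-1}\Sigma_{O_kM_k},\qquad d_k=\sigma^2+(\beta^*_{M_k})^TS_{M_k}\beta^*_{M_k},\qquad D_k^*=\frac{\sigma^2}{d_k}.$$ Let $\kappa_L,\kappa_U>0$. For each $k$ let $X_{O_k}$ (here the $n_k\times|O_k|$ design matrix) and $Y_{O_k}$ (the response vector) be the data of pattern $k$, and put $\hat\phi_k=(X_{O_k}^TX_{O_k})^{-1}X_{O_k}^TY_{O_k}$ and $\hat d_k=\frac1{n_k}\|Y_{O_k}-X_{O_k}\hat\phi_k\|_2^2$.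 Let $$\hat d_F^{(k)}=\begin{cases}\kappa_L&\text{if }\hat d_k\le\kappa_L/2,\\ \hat d_k&\text{if }\kappa_L/2<\hat d_k<2\kappa_U,\\ \kappa_U&\text{if }\hat d_k\ge2\kappa_U,\end{cases}\qquad \hat D_k=\frac{\sigma^2}{\hat d_F^{(k)}}.$$ **Theorem.** There is a universal constant $H$ such that the following holds. Let $0<\lambda_-\le\lambda_+$, $C\ge1$, $\chi\in(0,1]$, $q\ge1$ (real), $C_X>0$ and $\kappa_\epsilon\in\mathbb R$. There is a constant $F=F(\lambda_+,\lambda_-,C,\chi,q,C_X,\kappa_\epsilon)>0$ such that, in the setting above, for all $p,K,(O_k),(n_k),\beta^*,\sigma,\kappa_L,\kappa_U$ and every distribution of $(X,Y)$: if 1. $\mathbb P(|X^T\theta|\le t\sqrt{\theta^T\Sigma\theta})\le(Ct)^\chi$ for all $\theta\in\mathbb R^p\setminus\{0\}$ and $t>0$; 2. $\|X\|_{\psi_2}\le C_X$, where $\|X\|_{\psi_2}=\sup_{\|u\|_2=1}\inf\{c>0:\mathbb E\exp((u^TX)^2/c^2)\le2\}$; 3. all eigenvalues of $\Sigma$ lie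 in $[\lambda_-,\lambda_+]$; 4. $\mathbb E[|\epsilon|^{8q}]<\infty$ and $\mathbb E[|\epsilon|^{8q}]^{1/(4q)}\le\kappa_\epsilon\sigma^2$; 5. $\kappa_L\le d_k\le\kappa_U$ and $n_k\ge\dfrac{24q+6|O_k|}{\chi}$ for all $k\in[K]$; 6. $\displaystyle\max_{k\in[K]}\left\{\left(\frac{|O_k|}{n_k}\right)^q\left(\frac{\kappa_U}{\kappa_L}\right)^{16}\right\}\le\frac1F$, then all the expectations below are finite and $$\max_{k\in[K]}\left\{\mathbb E\left[\left(\frac{\hat D_k}{D_k^*}\right)^{16}\right]+\mathbb E\left[\left(\frac{D_k^*}{\hat D_k}\right)^{16}\right]\right\}\le H.$$ -/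

import Mathlib

open MeasureTheory ProbabilityTheory
open scoped ENNReal Matrix

noncomputable section

namespace BlockMissing

/-- The population second moment matrix `Σ = E[X Xᵀ]` when `(X, Y) ∼ P`. -/
def secondMoment {p : ℕ} (P : Measure ((Fin p → ℝ) × ℝ)) : Matrix (Fin p) (Fin p) ℝ :=
  Matrix.of fun i j => ∫ z, z.1 i * z.1 j ∂P

/-- The noise variable `ε = Y - Xᵀβ`. -/
def noise {p : ℕ} (β : Fin p → ℝ) (z : (Fin p → ℝ) × ℝ) : ℝ := z.2 - z.1 ⬝ᵥ β

/-- The σ-algebra generated by the covariates `X`. -/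
@[reducible] def covariateSigma (p : ℕ) : MeasurableSpace ((Fin p → ℝ) × ℝ) :=
  MeasurableSpace.comap Prod.fst inferInstance

/-- `P` is the joint law of `(X, Y)` in the linear model `Y = Xᵀβ + ε` with `E[ε | X] = 0` and
`Var[ε | X] = σ²`, where `X` has finite second moments. -/
structure IsLinearModel {p : ℕ} (P : Measure ((Fin p → ℝ) × ℝ)) (β : Fin p → ℝ) (σ : ℝ) :
    Prop where
  isProb : IsProbabilityMeasure P
  covariate_memLp : ∀ j, MemLp (fun z => z.1 j) 2 P
  noise_memLp : MemLp (noise β) 2 P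
  condExp_noise : P[noise β | covariateSigma p] =ᵐ[P] 0
  condVar_noise : Var[noise β; P | covariateSigma p] =ᵐ[P] fun _ => σ ^ 2

/-- Small-ball condition: `P(|Xᵀθ| ≤ t ‖θ‖_Σ) ≤ (C t)^χ` for all `θ ≠ 0` and `t > 0`,
where `‖θ‖_Σ² = θᵀΣθ`. -/
def SmallBall {p : ℕ} (P : Measure ((Fin p → ℝ) × ℝ)) (C χ : ℝ) : Prop :=
  ∀ θ : Fin p → ℝ, θ ≠ 0 → ∀ t : ℝ, 0 < t →
    P.real {z | |z.1 ⬝ᵥ θ| ≤ t * √(θ ⬝ᵥ (secondMoment P *ᵥ θ))} ≤ (C * t) ^ χ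

/-- The sub-Gaussian norm `‖Z‖_ψ₂ = inf {c > 0 : E exp(Z² / c²) ≤ 2}` of a real random variable
(equal to `∞` if there is no such `c`). -/
def psi2Norm {Ω : Type*} [MeasurableSpace Ω] (μ : Measure Ω) (Z : Ω → ℝ) : ℝ≥0∞ :=
  ⨅ (c : ℝ) (_ : 0 < c ∧ ∫⁻ ω, ENNReal.ofReal (Real.exp (Z ω ^ 2 / c ^ 2)) ∂μ ≤ 2),
    ENNReal.ofReal c

/-- The sub-Gaussian norm `‖X‖_ψ₂ = sup {‖uᵀX‖_ψ₂ : ‖u‖₂ = 1}` of the covariate vector. -/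
def covariatePsi2Norm {p : ℕ} (P : Measure ((Fin p → ℝ) × ℝ)) : ℝ≥0∞ :=
  ⨆ (u : Fin p → ℝ) (_ : u ⬝ᵥ u = 1), psi2Norm P (fun z => z.1 ⬝ᵥ u)

/-- `S_M = Σ_MM - Σ_MO Σ_OO⁻¹ Σ_OM`, where `M` is the complement of `O`. -/
def schur {p : ℕ} (S : Matrix (Fin p) (Fin p) ℝ) (O : Finset (Fin p)) :
    Matrix {i // i ∈ Oᶜ} {i // i ∈ Oᶜ} ℝ :=
  S.submatrix (↑) (↑) -
    S.submatrix (↑) ((↑) : {i // i ∈ O} → Fin p) *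
      (S.submatrix ((↑) : {i // i ∈ O} → Fin p) ((↑) : {i // i ∈ O} → Fin p))⁻¹ *
      S.submatrix ((↑) : {i // i ∈ O} → Fin p) (↑)

/-- `d = σ² + β_Mᵀ S_M β_M` for the pattern `O`, with `M` the complement of `O`. -/
def patternVar {p : ℕ} (S : Matrix (Fin p) (Fin p) ℝ) (β : Fin p → ℝ) (σ : ℝ)
    (O : Finset (Fin p)) : ℝ :=
  σ ^ 2 + (fun i : {i // i ∈ Oᶜ} => β i) ⬝ᵥ (schur S O *ᵥ fun i => β i)

/-- The oracle weight `D* = σ² / d`. -/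
def oracleWeight {p : ℕ} (S : Matrix (Fin p) (Fin p) ℝ) (β : Fin p → ℝ) (σ : ℝ)
    (O : Finset (Fin p)) : ℝ :=
  σ ^ 2 / patternVar S β σ O

/-- The data of one missingness pattern: `n` observations of `(X_O, Y)`. -/
abbrev PatternData {p : ℕ} (O : Finset (Fin p)) (n : ℕ) : Type :=
  Fin n → ({i // i ∈ O} → ℝ) × ℝ

/-- The law of `(X_O, Y)` when `(X, Y) ∼ P`. -/
def observedLaw {p : ℕ} (P : Measure ((Fin p → ℝ) × ℝ)) (O : Finset (Fin p)) :
    Measure (({i // i ∈ O} → ℝ) × ℝ) :=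
  P.map fun z => (fun i => z.1 i, z.2)

/-- The law of the labelled data: the patterns are independent and pattern `k` consists of
`n k` i.i.d. copies of `(X_{O k}, Y)`. -/
def labelledLaw {p K : ℕ} (P : Measure ((Fin p → ℝ) × ℝ)) (O : Fin K → Finset (Fin p))
    (n : Fin K → ℕ) : Measure (∀ k, PatternData (O k) (n k)) :=
  Measure.pi fun k => Measure.pi fun _ : Fin (n k) => observedLaw P (O k)

/-- The observed `n × |O|` design matrix. -/
def design {p n : ℕ} {O : Finset (Fin p)} (D : PatternData O n) :
    Matrix (Fin n) {i // i ∈ O} ℝ :=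
  Matrix.of fun i => (D i).1

/-- The observed response vector. -/
def response {p n : ℕ} {O : Finset (Fin p)} (D : PatternData O n) : Fin n → ℝ :=
  fun i => (D i).2

/-- The least squares coefficient `(X_Oᵀ X_O)⁻¹ X_Oᵀ Y_O`. -/
def leastSquares {p n : ℕ} {O : Finset (Fin p)} (D : PatternData O n) : {i // i ∈ O} → ℝ :=
  ((design D)ᵀ * design D)⁻¹ *ᵥ ((design D)ᵀ *ᵥ response D)

/-- The normalised residual sum of squares `n⁻¹ ‖Y_O - X_O φ̂‖₂²`. -/
def residualVar {p n : ℕ} {O : Finset (Fin p)} (D : PatternData O n) : ℝ :=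
  (1 / (n : ℝ)) * ∑ i, (response D i - (design D *ᵥ leastSquares D) i) ^ 2

/-- The clipping rule: `κL` if `d ≤ κL / 2`, `d` if `κL / 2 < d < 2 κU`, `κU` if `d ≥ 2 κU`. -/
def clipVar (κL κU d : ℝ) : ℝ :=
  if d ≤ κL / 2 then κL else if d < 2 * κU then d else κU

/-- The estimated weight `D̂ = σ² / d̂_F`, where `d̂_F` is the clipped residual variance. -/
def estWeight {p n : ℕ} {O : Finset (Fin p)} (σ κL κU : ℝ) (D : PatternData O n) : ℝ :=
  σ ^ 2 / clipVar κL κU (residualVar D)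

end BlockMissing

end

/-!
For one pattern write `m = |O|`, `d` for the population error variance `patternVar` and `d̂` for
`residualVar`. The clipped variance lies in `[κL / 2, 2 κU]`, so both weight ratios are always at
most `2 κU / κL`, and they are at most `2` as soon as `d / 2 ≤ d̂ ≤ 2 d`. Hence their 16-th moments
are at most `2 ^ 16 + (2 κU / κL) ^ 16 * P(d̂ ∉ [d / 2, 2 d])`, and it suffices that the deviation
probability is at most a constant times `(m / n) ^ q`: the smallness hypothesis on
`(m / n) ^ q (κU / κL) ^ 16` then leaves a universal bound. This hypothesis also yields `n ≥ A m`
for any constant `A` depending on the parameters, because `κL ≤ κU`.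

The deviation bound is `exists_residualVar_deviation_bound`. Let `φ` be the population least squares
coefficient of `Y` on `X_O` and `η = Y - X_Oᵀ φ`; then `E η² = d`, `E η X_O = 0`, and
`E η ^ (4N) ≤ M d ^ (2N)` for `N = ⌈q⌉` (`IsLinearModel.exists_errorMoments`, which takes the Schur
complement apart with `exists_unexplained_direction`). If the Gram matrix satisfies
`‖X v‖² ≥ t n ‖v‖²` for all `v`, then
`‖η‖² / n - ‖Xᵀη‖² / (t n²) ≤ d̂ ≤ ‖η‖² / n` (`le_residualVar`, `residualVar_le`). The vector `η`
is not independent of the design, but `‖η‖²` and the coordinates of `Xᵀη` are sums of i.i.d. variables with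
known mean, so an even moment inequality for such sums (`integral_sum_pow_le`) and Markov's
inequality bound their deviations by a multiple of `(m / n) ^ N ≤ (m / n) ^ q`.

The lower bound on the Gram matrix is `exists_smallest_singular_value_bound`. For a single unit
vector `v`, the small-ball condition bounds the probability that `‖X v‖²` is a small multiple of `n`
by `10⁻ⁿ`, and sub-Gaussianity does the same for a large multiple. A union bound over dyadic nets
of the unit ball, with at most `5 ^ (m j) ≤ 5 ^ n` points, extends both bounds to all `v`.
-/

/-! ### Moments of sums and exponential tail bounds -/

/-- The constant in the even moment bound for sums of independent centred variables. -/
def momentConst : ℕ → ℝ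
  | 0 => 1
  | N + 1 => 4 ^ (N + 1) * (momentConst N + 1)

theorem momentConst_pos : ∀ N, 0 < momentConst N
  | 0 => one_pos
  | N + 1 => by
    have := momentConst_pos N
    rw [momentConst]; positivity

/-- Second order expansion of an even power, with all terms beyond the linear one collected. -/
theorem add_pow_even_le (N : ℕ) (a b : ℝ) :
    (a + b) ^ (2 * (N + 1)) ≤ a ^ (2 * (N + 1)) + (2 * N + 2) * (a ^ (2 * N + 1) * b) +
      4 ^ (N + 1) * (a ^ (2 * N) * b ^ 2 + b ^ (2 * (N + 1))) := by
  have hterm : ∀ k ∈ Finset.range (2 * N + 1),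
      b ^ (k + 2) * a ^ (2 * (N + 1) - (k + 2)) * ((2 * (N + 1)).choose (k + 2) : ℝ) ≤
        (a ^ (2 * N) * b ^ 2 + b ^ (2 * (N + 1))) * ((2 * (N + 1)).choose (k + 2) : ℝ) := by
    intro k hk
    have hk' : k ≤ 2 * N := by simpa [Nat.lt_succ_iff] using hk
    refine mul_le_mul_of_nonneg_right ?_ (by positivity)
    have hsub : 2 * (N + 1) - (k + 2) = 2 * N - k := by omega
    have hsplit : |b| ^ k * |a| ^ (2 * N - k) ≤ a ^ (2 * N) + b ^ (2 * N) := by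
      have ha : a ^ (2 * N) = |a| ^ (2 * N) := ((even_two_mul N).pow_abs a).symm
      have hb : b ^ (2 * N) = |b| ^ (2 * N) := ((even_two_mul N).pow_abs b).symm
      rw [ha, hb]
      rcases le_total |a| |b| with h | h
      · calc |b| ^ k * |a| ^ (2 * N - k) ≤ |b| ^ k * |b| ^ (2 * N - k) := by gcongr
          _ = |b| ^ (2 * N) := by rw [← pow_add]; congr 1; omega
          _ ≤ _ := le_add_of_nonneg_left (by positivity)
      · calc |b| ^ k * |a| ^ (2 * N - k) ≤ |a| ^ k * |a| ^ (2 * N - k) := by gcongr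
          _ = |a| ^ (2 * N) := by rw [← pow_add]; congr 1; omega
          _ ≤ _ := le_add_of_nonneg_right (by positivity)
    rw [hsub]
    calc b ^ (k + 2) * a ^ (2 * N - k) ≤ |b ^ (k + 2) * a ^ (2 * N - k)| := le_abs_self _
      _ = b ^ 2 * (|b| ^ k * |a| ^ (2 * N - k)) := by
        rw [abs_mul, abs_pow, abs_pow, pow_add, sq_abs]; ring
      _ ≤ b ^ 2 * (a ^ (2 * N) + b ^ (2 * N)) := by gcongr
      _ = _ := by ring
  have hR : 0 ≤ a ^ (2 * N) * b ^ 2 + b ^ (2 * (N + 1)) := by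
    rw [pow_mul, pow_mul b]; positivity
  have hchoose : ∑ k ∈ Finset.range (2 * N + 1), ((2 * (N + 1)).choose (k + 2) : ℝ) ≤
      4 ^ (N + 1) := by
    have h := Nat.sum_range_choose (2 * (N + 1))
    rw [show 2 * (N + 1) + 1 = 2 * N + 1 + 1 + 1 by ring, Finset.sum_range_succ',
      Finset.sum_range_succ', pow_mul] at h
    have h' : ∑ k ∈ Finset.range (2 * N + 1), (2 * (N + 1)).choose (k + 2) ≤ 4 ^ (N + 1) := by
      rw [show (4 : ℕ) = 2 ^ 2 by norm_num, ← h, add_assoc]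
      exact Nat.le_add_right _ _
    exact_mod_cast h'
  rw [add_comm a b, add_pow, show 2 * (N + 1) + 1 = 2 * N + 1 + 1 + 1 by ring,
    Finset.sum_range_succ', Finset.sum_range_succ']
  have h1 := Finset.sum_le_sum hterm
  rw [← Finset.mul_sum] at h1
  have h2 := mul_le_mul_of_nonneg_left hchoose hR
  have e1 : 2 * (N + 1) - (0 + 1) = 2 * N + 1 := by omega
  rw [e1]
  simp only [pow_zero, Nat.sub_zero, zero_add, pow_one, Nat.choose_one_right, Nat.choose_zero_right,
    Nat.cast_one, mul_one, one_mul]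
  push_cast
  have e3 : ∀ k, k + 1 + 1 = k + 2 := fun k => rfl
  simp only [e3]
  linarith

theorem MeasureTheory.MemLp.integrable_pow_of_le {Ω : Type*} [MeasurableSpace Ω] {μ : Measure Ω}
    [IsFiniteMeasure μ] {f : Ω → ℝ} {p n : ℕ} (hf : MemLp f p μ) (hn : n ≤ p) :
    Integrable (fun ω => f ω ^ n) μ := by
  rcases Nat.eq_zero_or_pos n with rfl | h0
  · simp
  have h := (hf.mono_exponent (p := (n : ℝ≥0∞)) (by exact_mod_cast hn)).integrable_norm_pow h0.ne'
  refine (integrable_norm_iff (hf.1.pow n)).1 ?_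
  simpa [norm_pow] using h

theorem memLp_of_integrable_even_pow {Ω : Type*} [MeasurableSpace Ω] {μ : Measure Ω} {f : Ω → ℝ}
    {N : ℕ} (hN : N ≠ 0) (hm : AEStronglyMeasurable f μ)
    (hf : Integrable (fun ω => f ω ^ (2 * N)) μ) :
    MemLp f ((2 * N : ℕ) : ℝ≥0∞) μ := by
  refine (integrable_norm_rpow_iff hm (by simpa using hN) (ENNReal.natCast_ne_top _)).1 ?_
  refine hf.congr (Filter.Eventually.of_forall fun ω => ?_)
  simp only [ENNReal.toReal_natCast, Real.rpow_natCast, Real.norm_eq_abs]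
  rw [pow_mul, pow_mul, sq_abs]

/-- If `ξ` are independent and centred with `E ξᵢ ^ (2j) ≤ B ^ j` for all `1 ≤ j ≤ N`, then the sum
of `k` of them has `2N`-th moment at most `momentConst N * (B k) ^ N`. The proof is an induction on
`N` and then on `k`: in the expansion of `(S + ξ) ^ (2N)` the linear term has mean zero and the
quadratic one is controlled by the case `N - 1`. -/
theorem integral_sum_pow_le {Ω ι : Type*} [MeasurableSpace Ω] {μ : Measure Ω}
    [IsProbabilityMeasure μ] {ξ : ι → Ω → ℝ} (hind : iIndepFun ξ μ) (hmeas : ∀ i, Measurable (ξ i))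
    (hmean : ∀ i, ∫ ω, ξ i ω ∂μ = 0) {B : ℝ} (hB : 0 ≤ B) (N : ℕ)
    (hLp : ∀ i, MemLp (ξ i) ((2 * N : ℕ) : ℝ≥0∞) μ)
    (hmom : ∀ i, ∀ j, 1 ≤ j → j ≤ N → ∫ ω, ξ i ω ^ (2 * j) ∂μ ≤ B ^ j) (s : Finset ι) :
    ∫ ω, (∑ i ∈ s, ξ i ω) ^ (2 * N) ∂μ ≤ momentConst N * (B * s.card) ^ N := by
  classical
  induction N generalizing s with
  | zero => simp [momentConst]
  | succ N ih =>
    have hLp' : ∀ i, MemLp (ξ i) ((2 * N : ℕ) : ℝ≥0∞) μ := fun i =>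
      (hLp i).mono_exponent (by exact_mod_cast (by omega : 2 * N ≤ 2 * (N + 1)))
    have ih' := ih hLp' fun i j h1 h2 => hmom i j h1 (by omega)
    induction s using Finset.induction_on with
    | empty => simp
    | insert a s ha ihs =>
      set S : Ω → ℝ := fun ω => ∑ i ∈ s, ξ i ω with hS
      have hSLp : MemLp S ((2 * (N + 1) : ℕ) : ℝ≥0∞) μ := memLp_finsetSum s fun i _ => hLp i
      have hSm : Measurable S := Finset.measurable_fun_sum s fun i _ => hmeas i
      have hSi : IndepFun S (ξ a) μ := by
        have h := hind.indepFun_finsetSum_of_notMem hmeas ha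
        have e : ∑ j ∈ s, ξ j = S := by ext ω; simp [hS]
        rwa [e] at h
      have hpow : ∀ m n, IndepFun (fun ω => S ω ^ m) (fun ω => ξ a ω ^ n) μ := fun m n =>
        hSi.comp (measurable_id.pow_const m) (measurable_id.pow_const n)
      have hint : ∀ m n, m ≤ 2 * (N + 1) → n ≤ 2 * (N + 1) →
          Integrable (fun ω => S ω ^ m * ξ a ω ^ n) μ := fun m n hm hn =>
        (hpow m n).integrable_mul (hSLp.integrable_pow_of_le hm) ((hLp a).integrable_pow_of_le hn)
      have hmul : ∀ m n, ∫ ω, S ω ^ m * ξ a ω ^ n ∂μ = (∫ ω, S ω ^ m ∂μ) * ∫ ω, ξ a ω ^ n ∂μ :=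
        fun m n => (hpow m n).integral_fun_mul_eq_mul_integral
          (hSm.pow_const m).aestronglyMeasurable ((hmeas a).pow_const n).aestronglyMeasurable
      have i0 : Integrable (fun ω => S ω ^ (2 * (N + 1))) μ := hSLp.integrable_pow_of_le le_rfl
      have i1 : Integrable (fun ω => (2 * N + 2 : ℝ) * (S ω ^ (2 * N + 1) * ξ a ω)) μ := by
        have := hint (2 * N + 1) 1 (by omega) (by omega)
        simp only [pow_one] at this
        exact this.const_mul _
      have i2 := hint (2 * N) 2 (by omega) (by omega)
      have i3 : Integrable (fun ω => ξ a ω ^ (2 * (N + 1))) μ :=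
        (hLp a).integrable_pow_of_le le_rfl
      have hz : ∫ ω, S ω ^ (2 * N + 1) * ξ a ω ∂μ = 0 := by
        have := hmul (2 * N + 1) 1
        simpa [hmean a] using this
      have hle : ∫ ω, (S ω + ξ a ω) ^ (2 * (N + 1)) ∂μ ≤ ∫ ω, (S ω ^ (2 * (N + 1)) +
          (2 * N + 2) * (S ω ^ (2 * N + 1) * ξ a ω) +
          4 ^ (N + 1) * (S ω ^ (2 * N) * ξ a ω ^ 2 + ξ a ω ^ (2 * (N + 1)))) ∂μ :=
        integral_mono ((hSLp.add (hLp a)).integrable_pow_of_le le_rfl)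
          ((i0.add i1).add ((i2.add i3).const_mul _)) fun ω => add_pow_even_le N _ _
      have e : ∫ ω, (S ω ^ (2 * (N + 1)) +
          (2 * N + 2) * (S ω ^ (2 * N + 1) * ξ a ω) +
          4 ^ (N + 1) * (S ω ^ (2 * N) * ξ a ω ^ 2 + ξ a ω ^ (2 * (N + 1)))) ∂μ =
          ∫ ω, S ω ^ (2 * (N + 1)) ∂μ + 4 ^ (N + 1) * ((∫ ω, S ω ^ (2 * N) ∂μ) *
            (∫ ω, ξ a ω ^ 2 ∂μ) + ∫ ω, ξ a ω ^ (2 * (N + 1)) ∂μ) := by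
        have h1 := integral_add (i0.add i1) ((i2.add i3).const_mul (4 ^ (N + 1)))
        have h2 := integral_add i0 i1
        have h3 := integral_add i2 i3
        simp only [Pi.add_apply, integral_const_mul, hz, mul_zero, add_zero] at h1 h2 h3
        rw [h1, h2, h3, hmul]
      have hξ2 : ∫ ω, ξ a ω ^ 2 ∂μ ≤ B := by simpa using hmom a 1 le_rfl (by omega)
      have hξN := hmom a (N + 1) (by omega) le_rfl
      have hSN := ih' s
      have hK := momentConst_pos N
      set k : ℝ := (s.card : ℝ) with hk
      have hk0 : 0 ≤ k := Nat.cast_nonneg _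
      have hξ0 : 0 ≤ ∫ ω, ξ a ω ^ 2 ∂μ := integral_nonneg fun ω => sq_nonneg _
      have hprod : (∫ ω, S ω ^ (2 * N) ∂μ) * (∫ ω, ξ a ω ^ 2 ∂μ) ≤
          momentConst N * (B * k) ^ N * B :=
        mul_le_mul hSN hξ2 hξ0 (by positivity)
      have hcard : ((insert a s).card : ℝ) = k + 1 := by
        rw [Finset.card_insert_of_notMem ha]; push_cast; rfl
      have hsum : ∀ ω, ∑ i ∈ insert a s, ξ i ω = S ω + ξ a ω := fun ω => by
        rw [Finset.sum_insert ha, add_comm]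
      simp only [hsum, hcard]
      have hpk : k ^ (N + 1) + (k + 1) ^ N ≤ (k + 1) ^ (N + 1) := by
        have : k ^ N ≤ (k + 1) ^ N := by gcongr; linarith
        rw [pow_succ, pow_succ]
        nlinarith
      have hpk2 : k ^ N ≤ (k + 1) ^ N := by gcongr; linarith
      have hpk3 : (1 : ℝ) ≤ (k + 1) ^ N := one_le_pow₀ (by linarith)
      calc _ ≤ _ := hle.trans_eq e
        _ ≤ momentConst (N + 1) * (B * k) ^ (N + 1) +
            4 ^ (N + 1) * (momentConst N * (B * k) ^ N * B + B ^ (N + 1)) := by gcongr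
        _ = B ^ (N + 1) * (momentConst (N + 1) * k ^ (N + 1) +
            4 ^ (N + 1) * (momentConst N * k ^ N + 1)) := by
          simp only [mul_pow]; ring
        _ ≤ B ^ (N + 1) * (momentConst (N + 1) * k ^ (N + 1) +
            4 ^ (N + 1) * (momentConst N * (k + 1) ^ N + (k + 1) ^ N)) := by gcongr
        _ = B ^ (N + 1) * (momentConst (N + 1) * (k ^ (N + 1) + (k + 1) ^ N)) := by
          rw [momentConst]; ring
        _ ≤ B ^ (N + 1) * (momentConst (N + 1) * (k + 1) ^ (N + 1)) := by
          have := momentConst_pos (N + 1)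
          gcongr
        _ = _ := by rw [mul_pow]; ring

/-- A bound on the `2N`-th moment bounds the lower even moments, at the price of a factor two. -/
theorem integral_pow_le_of_le {Ω : Type*} [MeasurableSpace Ω] {μ : Measure Ω}
    [IsProbabilityMeasure μ] {f : Ω → ℝ} {B : ℝ} (hB : 0 < B) {N j : ℕ} (hj1 : 1 ≤ j) (hj : j ≤ N)
    (hLp : MemLp f ((2 * N : ℕ) : ℝ≥0∞) μ) (hN : ∫ ω, f ω ^ (2 * N) ∂μ ≤ B ^ N) :
    ∫ ω, f ω ^ (2 * j) ∂μ ≤ (2 * B) ^ j := by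
  have hpt : ∀ ω, f ω ^ (2 * j) ≤ B ^ j * (1 + f ω ^ (2 * N) / B ^ N) := by
    intro ω
    set x := f ω ^ 2 / B with hx
    have hx0 : 0 ≤ x := by positivity
    have e : ∀ n, f ω ^ (2 * n) = B ^ n * x ^ n := fun n => by
      rw [pow_mul, ← mul_pow, hx, mul_div_cancel₀ _ hB.ne']
    rw [e, e, mul_div_cancel_left₀ _ (by positivity)]
    gcongr
    rcases le_total x 1 with h | h
    · exact (pow_le_one₀ hx0 h).trans (le_add_of_nonneg_right (by positivity))
    · exact (pow_le_pow_right₀ h hj).trans (le_add_of_nonneg_left zero_le_one)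
  have iN : Integrable (fun ω => f ω ^ (2 * N)) μ := hLp.integrable_pow_of_le le_rfl
  calc ∫ ω, f ω ^ (2 * j) ∂μ ≤ ∫ ω, B ^ j * (1 + f ω ^ (2 * N) / B ^ N) ∂μ :=
        integral_mono (hLp.integrable_pow_of_le (by omega))
          (((integrable_const _).add (iN.div_const _)).const_mul _) hpt
    _ = B ^ j * (1 + (∫ ω, f ω ^ (2 * N) ∂μ) / B ^ N) := by
      rw [integral_const_mul, integral_add (integrable_const _) (iN.div_const _), integral_div]
      simp
    _ ≤ B ^ j * (1 + 1) := by
      gcongr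
      exact div_le_one_of_le₀ hN (by positivity)
    _ ≤ B ^ j * 2 ^ j := by
      gcongr
      calc (1 + 1 : ℝ) = 2 ^ 1 := by norm_num
        _ ≤ 2 ^ j := pow_le_pow_right₀ (by norm_num) hj1
    _ = _ := by rw [mul_pow, mul_comm]

/-- Moment bound for a sum over an i.i.d. sample of a centred function of the observations. -/
theorem integral_sample_sum_pow_le {Ω : Type*} [MeasurableSpace Ω] {Q : Measure Ω}
    [IsProbabilityMeasure Q] {f : Ω → ℝ} (hf : Measurable f) (hmean : ∫ z, f z ∂Q = 0) {B : ℝ}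
    (hB : 0 < B) {N : ℕ} (hLp : MemLp f ((2 * N : ℕ) : ℝ≥0∞) Q)
    (hmom : ∫ z, f z ^ (2 * N) ∂Q ≤ B ^ N) (n : ℕ) :
    Integrable (fun D : Fin n → Ω => (∑ i, f (D i)) ^ (2 * N)) (Measure.pi fun _ => Q) ∧
    ∫ D, (∑ i, f (D i)) ^ (2 * N) ∂(Measure.pi fun _ : Fin n => Q) ≤
      momentConst N * (2 * B * n) ^ N := by
  have hmp : ∀ i, MeasurePreserving (Function.eval i) (Measure.pi fun _ : Fin n => Q) Q :=
    fun i => measurePreserving_eval (fun _ : Fin n => Q) i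
  have hLp' : ∀ i : Fin n, MemLp (fun D : Fin n → Ω => f (D i)) ((2 * N : ℕ) : ℝ≥0∞)
      (Measure.pi fun _ => Q) := fun i => hLp.comp_measurePreserving (hmp i)
  have hint : ∀ (i : Fin n) (g : Ω → ℝ), Measurable g →
      ∫ D, g (D i) ∂(Measure.pi fun _ : Fin n => Q) = ∫ z, g z ∂Q := fun i g hg => by
    have h := integral_map (μ := Measure.pi fun _ : Fin n => Q) (hmp i).measurable.aemeasurable
      hg.aestronglyMeasurable
    rw [(hmp i).map_eq] at h
    exact h.symm
  refine ⟨(memLp_finsetSum Finset.univ fun i _ => hLp' i).integrable_pow_of_le le_rfl, ?_⟩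
  have := integral_sum_pow_le (μ := Measure.pi fun _ : Fin n => Q)
    (ξ := fun (i : Fin n) (D : Fin n → Ω) => f (D i))
    (iIndepFun_pi (X := fun _ : Fin n => f) fun _ => hf.aemeasurable)
    (fun i => hf.comp (measurable_pi_apply i)) (fun i => by rw [hint i f hf, hmean])
    (B := 2 * B) (by positivity) N hLp'
    (fun i j h1 h2 => by
      rw [hint i (fun z => f z ^ (2 * j)) (hf.pow_const _)]
      exact integral_pow_le_of_le hB h1 h2 hLp hmom) Finset.univ
  simpa using this

/-- Chernoff bound for an i.i.d. sample. -/
theorem sample_sum_ge_le {Ω : Type*} [MeasurableSpace Ω] {Q : Measure Ω}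
    [IsProbabilityMeasure Q] {f : Ω → ℝ} (hf : Measurable f)
    (hi : Integrable (fun z => Real.exp (f z)) Q) {a b r : ℝ} (ha : ∫ z, Real.exp (f z) ∂Q ≤ a)
    (hr : Real.exp (-b) * a ≤ r) (n : ℕ) :
    (Measure.pi fun _ : Fin n => Q).real {D | n * b ≤ ∑ i, f (D i)} ≤ r ^ n := by
  have hmp : ∀ i, MeasurePreserving (Function.eval i) (Measure.pi fun _ : Fin n => Q) Q :=
    fun i => measurePreserving_eval (fun _ : Fin n => Q) i
  set X : Fin n → (Fin n → Ω) → ℝ := fun i D => f (D i) with hX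
  have hind : iIndepFun X (Measure.pi fun _ : Fin n => Q) :=
    iIndepFun_pi (X := fun _ : Fin n => f) fun _ => hf.aemeasurable
  have hXm : ∀ i, Measurable (X i) := fun i => hf.comp (measurable_pi_apply i)
  have hXi : ∀ i, Integrable (fun D => Real.exp (1 * X i D)) (Measure.pi fun _ : Fin n => Q) := by
    intro i
    simp only [one_mul]
    exact (hmp i).integrable_comp_of_integrable hi
  have hmgf : ∀ i, mgf (X i) (Measure.pi fun _ : Fin n => Q) 1 = ∫ z, Real.exp (f z) ∂Q := by
    intro i
    simp only [mgf, one_mul]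
    have h := integral_map (μ := Measure.pi fun _ : Fin n => Q) (hmp i).measurable.aemeasurable
      (f := fun z => Real.exp (f z)) (hf.exp).aestronglyMeasurable
    rw [(hmp i).map_eq] at h
    exact h.symm
  have h0 : 0 ≤ ∫ z, Real.exp (f z) ∂Q := integral_nonneg fun z => (Real.exp_pos _).le
  have h := measure_ge_le_exp_mul_mgf (μ := Measure.pi fun _ : Fin n => Q)
    (X := ∑ i, X i) (t := 1) (n * b) zero_le_one
    (hind.integrable_exp_mul_sum hXm fun i _ => hXi i)
  rw [hind.mgf_sum hXm] at h
  simp only [hmgf, Finset.prod_const, Finset.card_univ, Fintype.card_fin] at h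
  have e : {D : Fin n → Ω | n * b ≤ ∑ i, f (D i)} = {D | n * b ≤ (∑ i, X i) D} := by
    ext D; simp [hX]
  rw [e]
  refine h.trans ?_
  rw [show -1 * (n * b) = n * (-b) by ring, Real.exp_nat_mul, ← mul_pow]
  gcongr
  exact (mul_le_mul_of_nonneg_left ha (Real.exp_pos _).le).trans hr

/-! ### Nets of the unit ball and the smallest singular value of the design -/

section Nets

variable {E F : Type*} [NormedAddCommGroup E] [NormedSpace ℝ E] [NormedAddCommGroup F]
  [NormedSpace ℝ F]

/-- The unit ball of a `d`-dimensional space has a `1/2`-net of at most `5 ^ d` points: a separated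
set of largest cardinality is such a net. -/
theorem exists_half_net [FiniteDimensional ℝ E] : ∃ s : Finset E,
    s.card ≤ 5 ^ Module.finrank ℝ E ∧ (∀ u ∈ s, ‖u‖ ≤ 1) ∧
      ∀ v : E, ‖v‖ ≤ 1 → ∃ u ∈ s, ‖v - u‖ ≤ 1 / 2 := by
  classical
  let good : Finset E → Prop := fun s =>
    (∀ u ∈ s, ‖u‖ ≤ 1) ∧ ∀ u ∈ s, ∀ w ∈ s, u ≠ w → 1 / 2 ≤ ‖u - w‖
  have hcard : ∀ s, good s → s.card ≤ 5 ^ Module.finrank ℝ E := by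
    rintro s ⟨h1, h2⟩
    -- the packing bound in Mathlib is for the ball of radius two and separation one
    have hinj : Function.Injective fun u : E => (2 : ℝ) • u := smul_right_injective E two_ne_zero
    rw [← Finset.card_image_of_injective s hinj]
    refine Besicovitch.card_le_of_separated _ ?_ ?_
    · intro c hc
      obtain ⟨u, hu, rfl⟩ := Finset.mem_image.1 hc
      rw [norm_smul, Real.norm_two]
      linarith [h1 u hu]
    · intro c hc d hd hcd
      obtain ⟨u, hu, rfl⟩ := Finset.mem_image.1 hc
      obtain ⟨w, hw, rfl⟩ := Finset.mem_image.1 hd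
      rw [← smul_sub, norm_smul, Real.norm_two]
      linarith [h2 u hu w hw fun h => hcd (by rw [h])]
  obtain ⟨s, hs, hmax⟩ := Nat.findGreatest_spec
    (P := fun k => ∃ s, good s ∧ s.card = k) (n := 5 ^ Module.finrank ℝ E) (Nat.zero_le _)
    ⟨∅, by simp [good], rfl⟩
  refine ⟨s, hcard s hs, hs.1, fun v hv => ?_⟩
  by_contra! hfar
  have hvs : v ∉ s := fun h => by
    have := hfar v h
    simp at this
    linarith
  have hgood : good (insert v s) := by
    refine ⟨fun u hu => ?_, fun u hu w hw huw => ?_⟩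
    · rcases Finset.mem_insert.1 hu with rfl | hu
      exacts [hv, hs.1 u hu]
    · rcases Finset.mem_insert.1 hu with h1 | h1 <;> rcases Finset.mem_insert.1 hw with h2 | h2
      · exact absurd (h1.trans h2.symm) huw
      · rw [h1]; exact (hfar w h2).le
      · rw [h2, norm_sub_rev]; exact (hfar u h1).le
      · exact hs.2 u h1 w h2 huw
  have h := Nat.le_findGreatest (P := fun k => ∃ s, good s ∧ s.card = k) (hcard _ hgood)
    ⟨_, hgood, rfl⟩
  rw [Finset.card_insert_of_notMem hvs, hmax] at h
  omega

/-- Finer nets, obtained by expanding a vector dyadically along the `1/2`-net. -/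
theorem exists_dyadic_net [FiniteDimensional ℝ E] (j : ℕ) : ∃ t : Finset E,
    t.card ≤ (5 ^ Module.finrank ℝ E) ^ j ∧
      ∀ v : E, ‖v‖ ≤ 1 → ∃ u ∈ t, ‖v - u‖ ≤ (1 / 2) ^ j := by
  classical
  obtain ⟨s, hs, -, hs2⟩ := exists_half_net (E := E)
  induction j with
  | zero => exact ⟨{0}, by simp, fun v hv => ⟨0, by simp, by simpa using hv⟩⟩
  | succ j ih =>
    obtain ⟨t, ht, ht2⟩ := ih
    refine ⟨(t ×ˢ s).image fun q => q.1 + ((1 / 2 : ℝ) ^ j) • q.2, ?_, fun v hv => ?_⟩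
    · refine Finset.card_image_le.trans ?_
      rw [Finset.card_product, pow_succ]
      exact Nat.mul_le_mul ht hs
    · obtain ⟨u, hu, huv⟩ := ht2 v hv
      obtain ⟨w, hw, hwv⟩ := hs2 ((2 : ℝ) ^ j • (v - u)) (by
        rw [norm_smul, norm_pow, Real.norm_two]
        calc (2 : ℝ) ^ j * ‖v - u‖ ≤ 2 ^ j * (1 / 2) ^ j := by gcongr
          _ = 1 := by rw [← mul_pow]; norm_num)
      refine ⟨_, Finset.mem_image.2 ⟨(u, w), Finset.mem_product.2 ⟨hu, hw⟩, rfl⟩, ?_⟩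
      have e : v - (u + ((1 / 2 : ℝ) ^ j) • w) =
          ((1 / 2 : ℝ) ^ j) • ((2 : ℝ) ^ j • (v - u) - w) := by
        rw [smul_sub, smul_smul, ← mul_pow]
        norm_num
        abel
      simp only [e]
      rw [norm_smul, norm_pow, pow_succ, Real.norm_of_nonneg (by norm_num : (0 : ℝ) ≤ 1 / 2)]
      gcongr

theorem opNorm_le_of_half_net {s : Finset E} (hs : ∀ v : E, ‖v‖ ≤ 1 → ∃ u ∈ s, ‖v - u‖ ≤ 1 / 2)
    (L : E →L[ℝ] F) {M : ℝ} (hM : 0 ≤ M) (h : ∀ u ∈ s, ‖L u‖ ≤ M) : ‖L‖ ≤ 2 * M := by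
  have key : ‖L‖ ≤ M + ‖L‖ / 2 := by
    refine L.opNorm_le_of_unit_norm (by positivity) fun v hv => ?_
    obtain ⟨u, hu, huv⟩ := hs v hv.le
    calc ‖L v‖ = ‖L u + L (v - u)‖ := by rw [← map_add]; congr 2; abel
      _ ≤ ‖L u‖ + ‖L‖ * ‖v - u‖ := (norm_add_le _ _).trans (by gcongr; exact L.le_opNorm _)
      _ ≤ M + ‖L‖ * (1 / 2) := by gcongr; exact h u hu
      _ = _ := by ring
  linarith

/-- A bound from below on a net passes to all vectors when the net is fine compared with the
operator norm. -/
theorem le_norm_of_net {t : Finset E} {δ : ℝ} (hδ : δ ≤ 1 / 2)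
    (ht : ∀ v : E, ‖v‖ ≤ 1 → ∃ u ∈ t, ‖v - u‖ ≤ δ) (L : E →L[ℝ] F) {a : ℝ} (ha : 0 ≤ a)
    (h : ∀ u ∈ t, u ≠ 0 → a * ‖u‖ ≤ ‖L u‖) (hL : δ * ‖L‖ ≤ a / 4) (v : E) :
    a / 4 * ‖v‖ ≤ ‖L v‖ := by
  rcases eq_or_ne v 0 with rfl | hv
  · simp
  have hv0 : 0 < ‖v‖ := norm_pos_iff.2 hv
  set w : E := ‖v‖⁻¹ • v with hw
  have hw1 : ‖w‖ = 1 := by rw [hw, norm_smul, norm_inv, norm_norm, inv_mul_cancel₀ hv0.ne']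
  have hvw : v = ‖v‖ • w := by rw [hw, smul_smul, mul_inv_cancel₀ hv0.ne', one_smul]
  obtain ⟨u, hu, huw⟩ := ht w hw1.le
  have hu1 : 1 / 2 ≤ ‖u‖ := by
    have := norm_sub_norm_le w u
    linarith
  have hu0 : u ≠ 0 := norm_pos_iff.1 (by linarith)
  have h1 : a / 2 ≤ ‖L u‖ := le_trans (by nlinarith) (h u hu hu0)
  have h2 : ‖L (w - u)‖ ≤ a / 4 :=
    (L.le_opNorm _).trans ((mul_le_mul_of_nonneg_left huw (norm_nonneg _)).trans
      (by rwa [mul_comm]))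
  have h3 : ‖L u‖ - ‖L (w - u)‖ ≤ ‖L w‖ := by
    have := norm_sub_norm_le (L u) (L (u - w))
    rw [← map_sub, sub_sub_cancel, ← neg_sub w u, map_neg, norm_neg] at this
    exact this
  conv_rhs => rw [hvw, map_smul, norm_smul, norm_norm, mul_comm]
  gcongr
  linarith

end Nets

/-- The map `v ↦ X v` for the design matrix `X` of a sample, between Euclidean spaces. -/
noncomputable def designCLM {ι : Type*} [Fintype ι] {n : ℕ} (D : Fin n → (ι → ℝ) × ℝ) :
    EuclideanSpace ℝ ι →L[ℝ] EuclideanSpace ℝ (Fin n) :=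
  LinearMap.toContinuousLinearMap
    { toFun := fun v => WithLp.toLp 2 fun i => (D i).1 ⬝ᵥ v.ofLp
      map_add' := fun v w => by ext i; simp [dotProduct_add]
      map_smul' := fun a v => by ext i; simp [dotProduct_smul] }

theorem norm_designCLM_sq {ι : Type*} [Fintype ι] {n : ℕ} (D : Fin n → (ι → ℝ) × ℝ)
    (v : EuclideanSpace ℝ ι) : ‖designCLM D v‖ ^ 2 = ∑ i, ((D i).1 ⬝ᵥ v.ofLp) ^ 2 := by
  rw [EuclideanSpace.norm_sq_eq]
  simp [designCLM]

theorem EuclideanSpace.norm_sq_eq_dotProduct {ι : Type*} [Fintype ι] (v : EuclideanSpace ℝ ι) :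
    ‖v‖ ^ 2 = v.ofLp ⬝ᵥ v.ofLp := by
  rw [EuclideanSpace.norm_sq_eq]
  simp [dotProduct, sq]

/-- Direction-wise bounds for the design: sub-Gaussian with constant `c`, and not concentrated near
zero at scale `s`. -/
structure DirectionBounds {ι : Type*} [Fintype ι] (Q : Measure ((ι → ℝ) × ℝ)) (c s : ℝ) :
    Prop where
  integrable_exp : ∀ v : ι → ℝ, v ⬝ᵥ v = 1 →
    Integrable (fun z => Real.exp ((z.1 ⬝ᵥ v) ^ 2 / c ^ 2)) Q
  integral_exp : ∀ v : ι → ℝ, v ⬝ᵥ v = 1 → ∫ z, Real.exp ((z.1 ⬝ᵥ v) ^ 2 / c ^ 2) ∂Q ≤ 2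
  smallBall : ∀ v : ι → ℝ, v ⬝ᵥ v = 1 → Q.real {z | |z.1 ⬝ᵥ v| ≤ s} ≤ 1 / 60

theorem measurable_fst_dotProduct {ι : Type*} [Fintype ι] (v : ι → ℝ) :
    Measurable fun z : (ι → ℝ) × ℝ => z.1 ⬝ᵥ v := by
  unfold dotProduct; fun_prop

namespace DirectionBounds

variable {ι : Type*} [Fintype ι] {Q : Measure ((ι → ℝ) × ℝ)} [IsProbabilityMeasure Q] {c s : ℝ}

/-- The scale `c² log 20` makes the failure probability `10⁻ⁿ`, small enough for a union bound over
the at most `5ⁿ` points of a net. -/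
theorem sample_upper (h : DirectionBounds Q c s) (hc : 0 < c) {v : ι → ℝ} (hv : v ⬝ᵥ v = 1)
    (n : ℕ) : (Measure.pi fun _ : Fin n => Q).real
      {D | c ^ 2 * Real.log 20 * n ≤ ∑ i, ((D i).1 ⬝ᵥ v) ^ 2} ≤ (1 / 10) ^ n := by
  have hm : Measurable fun z : (ι → ℝ) × ℝ => (z.1 ⬝ᵥ v) ^ 2 / c ^ 2 :=
    ((measurable_fst_dotProduct v).pow_const 2).div_const _
  have := sample_sum_ge_le hm (h.integrable_exp v hv) (h.integral_exp v hv) (b := Real.log 20)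
    (r := 1 / 10) (by rw [Real.exp_neg, Real.exp_log (by norm_num)]; norm_num) n
  refine le_trans (le_of_eq ?_) this
  congr 1
  ext D
  rw [Set.mem_ofPred_eq, Set.mem_ofPred_eq, ← Finset.sum_div, le_div_iff₀ (by positivity)]
  ring_nf

/-- Away from a set of probability `1/60` the variable `exp (-(xᵀv)² / τ)` is at most `1/60` for
`τ = s² / log 60`, which makes the normalised sum of squares small with exponentially small
probability only. -/
theorem sample_lower (h : DirectionBounds Q c s) (hs : 0 < s) {v : ι → ℝ} (hv : v ⬝ᵥ v = 1)
    (n : ℕ) : (Measure.pi fun _ : Fin n => Q).real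
      {D | ∑ i, ((D i).1 ⬝ᵥ v) ^ 2 ≤ s ^ 2 / Real.log 60 * n} ≤ (1 / 10) ^ n := by
  set τ := s ^ 2 / Real.log 60 with hτ
  have hlog : 0 < Real.log 60 := Real.log_pos (by norm_num)
  have hτ0 : 0 < τ := by positivity
  have hmz := measurable_fst_dotProduct v
  have hm : Measurable fun z : (ι → ℝ) × ℝ => -((z.1 ⬝ᵥ v) ^ 2 / τ) :=
    ((hmz.pow_const 2).div_const _).neg
  have hset : MeasurableSet {z : (ι → ℝ) × ℝ | |z.1 ⬝ᵥ v| ≤ s} :=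
    measurableSet_le (by simpa [Real.norm_eq_abs] using hmz.norm) measurable_const
  have hpt : ∀ z : (ι → ℝ) × ℝ, Real.exp (-((z.1 ⬝ᵥ v) ^ 2 / τ)) ≤
      Set.indicator {z : (ι → ℝ) × ℝ | |z.1 ⬝ᵥ v| ≤ s} (fun _ => (1 : ℝ)) z + 1 / 60 := by
    intro z
    by_cases hz : |z.1 ⬝ᵥ v| ≤ s
    · rw [Set.indicator_of_mem (by exact hz)]
      have : Real.exp (-((z.1 ⬝ᵥ v) ^ 2 / τ)) ≤ 1 := Real.exp_le_one_iff.2 (by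
        rw [neg_nonpos]; positivity)
      linarith
    · rw [Set.indicator_of_notMem (by exact hz), zero_add]
      have h1 : s ^ 2 ≤ (z.1 ⬝ᵥ v) ^ 2 := by
        rw [← sq_abs (z.1 ⬝ᵥ v)]
        exact pow_le_pow_left₀ hs.le (not_le.1 hz).le 2
      have h2 : Real.log 60 ≤ (z.1 ⬝ᵥ v) ^ 2 / τ := by
        rw [le_div_iff₀ hτ0, hτ, mul_div_cancel₀ _ hlog.ne']
        exact h1
      calc _ ≤ Real.exp (-Real.log 60) := Real.exp_le_exp.2 (neg_le_neg h2)
        _ = 1 / 60 := by rw [Real.exp_neg, Real.exp_log (by norm_num)]; norm_num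
  have hint : Integrable (fun z : (ι → ℝ) × ℝ => Real.exp (-((z.1 ⬝ᵥ v) ^ 2 / τ))) Q := by
    refine (integrable_const (1 : ℝ)).mono' hm.exp.aestronglyMeasurable
      (Filter.Eventually.of_forall fun z => ?_)
    rw [Real.norm_of_nonneg (Real.exp_pos _).le]
    exact Real.exp_le_one_iff.2 (by rw [neg_nonpos]; positivity)
  have hind : Integrable (Set.indicator {z : (ι → ℝ) × ℝ | |z.1 ⬝ᵥ v| ≤ s} fun _ => (1 : ℝ)) Q :=
    (integrable_const (1 : ℝ)).indicator hset
  have hle : ∫ z, Real.exp (-((z.1 ⬝ᵥ v) ^ 2 / τ)) ∂Q ≤ 1 / 30 := by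
    calc _ ≤ _ := integral_mono hint (hind.add (integrable_const (1 / 60))) hpt
      _ = Q.real {z : (ι → ℝ) × ℝ | |z.1 ⬝ᵥ v| ≤ s} + 1 / 60 := by
        simp only [Pi.add_apply]
        rw [integral_add hind (integrable_const _), integral_indicator hset]
        simp
      _ ≤ 1 / 60 + 1 / 60 := by gcongr; exact h.smallBall v hv
      _ = _ := by norm_num
  have := sample_sum_ge_le hm hint hle (b := -1) (r := 1 / 10) (by
    rw [neg_neg]
    linarith [Real.exp_one_lt_d9]) n
  refine le_trans (le_of_eq ?_) this
  congr 1
  ext D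
  rw [Set.mem_ofPred_eq, Set.mem_ofPred_eq, Finset.sum_neg_distrib, ← Finset.sum_div, mul_neg_one,
    neg_le_neg_iff, div_le_iff₀ hτ0, mul_comm]

end DirectionBounds

theorem normalize_dotProduct_self {ι : Type*} [Fintype ι] {u : EuclideanSpace ℝ ι} (hu : u ≠ 0) :
    (‖u‖⁻¹ • u).ofLp ⬝ᵥ (‖u‖⁻¹ • u).ofLp = 1 := by
  rw [← EuclideanSpace.norm_sq_eq_dotProduct, norm_smul, norm_inv, norm_norm,
    inv_mul_cancel₀ (norm_ne_zero_iff.2 hu), one_pow]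

/-- Smallest singular value: with exponentially small exceptional probability, the Gram matrix of
the design is bounded below by a multiple of `n`, as soon as `n` is at least a constant multiple of
the dimension. -/
theorem exists_smallest_singular_value_bound {c s : ℝ} (hc : 0 < c) (hs : 0 < s) :
    ∃ t A : ℝ, 0 < t ∧ 1 ≤ A ∧ ∀ (ι : Type) [Fintype ι] (Q : Measure ((ι → ℝ) × ℝ))
      [IsProbabilityMeasure Q], DirectionBounds Q c s → ∀ n : ℕ, A * Fintype.card ι ≤ n →
        (Measure.pi fun _ : Fin n => Q).real
          {D | ∃ v : ι → ℝ, ∑ i, ((D i).1 ⬝ᵥ v) ^ 2 < t * n * (v ⬝ᵥ v)} ≤ 2 * (1 / 2) ^ n := by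
  have hlog : 0 < Real.log 60 := Real.log_pos (by norm_num)
  have hlog' : 0 < Real.log 20 := Real.log_pos (by norm_num)
  set τ := s ^ 2 / Real.log 60 with hτ
  set B := c ^ 2 * Real.log 20 with hB
  have hτ0 : 0 < τ := by positivity
  have hB0 : 0 < B := by positivity
  -- the mesh of the net: the upper bound on the operator norm times the mesh has to be below the
  -- lower bound on the net
  obtain ⟨j, hj⟩ := exists_pow_lt_of_lt_one (y := (1 / 2 : ℝ))
    (show 0 < √τ / (8 * √B) by positivity) (by norm_num)
  have hfine : (1 / 2 : ℝ) ^ (j + 1) * (2 * √B) ≤ √τ / 4 := by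
    have h1 : (1 / 2 : ℝ) ^ (j + 1) ≤ √τ / (8 * √B) :=
      (pow_le_pow_of_le_one (by norm_num) (by norm_num) (Nat.le_succ j)).trans hj.le
    calc _ ≤ √τ / (8 * √B) * (2 * √B) := by gcongr
      _ = √τ / 4 := by
        have : √B ≠ 0 := by positivity
        field_simp
        norm_num
  refine ⟨τ / 16, (j + 1 : ℕ), by positivity, by simp, fun ι _ Q _ hQ n hn => ?_⟩
  obtain ⟨S, hScard, hS1, hS⟩ := exists_half_net (E := EuclideanSpace ℝ ι)
  obtain ⟨T, hTcard, hT⟩ := exists_dyadic_net (E := EuclideanSpace ℝ ι) (j + 1)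
  rw [finrank_euclideanSpace] at hScard hTcard
  have hn' : (j + 1) * Fintype.card ι ≤ n := by exact_mod_cast hn
  set μ := Measure.pi fun _ : Fin n => Q with hμ
  let dir : EuclideanSpace ℝ ι → (ι → ℝ) := fun u => (‖u‖⁻¹ • u).ofLp
  let U : EuclideanSpace ℝ ι → Set (Fin n → (ι → ℝ) × ℝ) := fun u =>
    {D | u ≠ 0 ∧ B * n ≤ ∑ i, ((D i).1 ⬝ᵥ dir u) ^ 2}
  let V : EuclideanSpace ℝ ι → Set (Fin n → (ι → ℝ) × ℝ) := fun u =>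
    {D | u ≠ 0 ∧ ∑ i, ((D i).1 ⬝ᵥ dir u) ^ 2 ≤ τ * n}
  have hU : ∀ u, μ.real (U u) ≤ (1 / 10) ^ n := fun u => by
    rcases eq_or_ne u 0 with h0 | h0
    · simp [U, h0]
    · exact (measureReal_mono fun D hD => hD.2).trans
        (hQ.sample_upper hc (normalize_dotProduct_self h0) n)
  have hV : ∀ u, μ.real (V u) ≤ (1 / 10) ^ n := fun u => by
    rcases eq_or_ne u 0 with h0 | h0
    · simp [V, h0]
    · exact (measureReal_mono fun D hD => hD.2).trans
        (hQ.sample_lower hs (normalize_dotProduct_self h0) n)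
  have hnorm : ∀ (D : Fin n → (ι → ℝ) × ℝ) (u : EuclideanSpace ℝ ι), u ≠ 0 →
      ‖designCLM D u‖ = ‖u‖ * √(∑ i, ((D i).1 ⬝ᵥ dir u) ^ 2) := fun D u hu => by
    have h1 : u = ‖u‖ • (‖u‖⁻¹ • u) := by
      rw [smul_smul, mul_inv_cancel₀ (norm_ne_zero_iff.2 hu), one_smul]
    conv_lhs => rw [h1, map_smul, norm_smul, norm_norm]
    rw [← norm_designCLM_sq D (‖u‖⁻¹ • u), Real.sqrt_sq (norm_nonneg _)]
  have hsub : {D : Fin n → (ι → ℝ) × ℝ | ∃ v : ι → ℝ,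
      ∑ i, ((D i).1 ⬝ᵥ v) ^ 2 < τ / 16 * n * (v ⬝ᵥ v)} ⊆ (⋃ u ∈ S, U u) ∪ ⋃ u ∈ T, V u := by
    rintro D ⟨v, hv⟩
    by_contra hD
    simp only [Set.mem_union, Set.mem_iUnion, not_or, not_exists] at hD
    obtain ⟨hDU, hDV⟩ := hD
    have hup : ∀ u ∈ S, ‖designCLM D u‖ ≤ √(B * n) := fun u hu => by
      rcases eq_or_ne u 0 with rfl | h0
      · rw [map_zero, norm_zero]; positivity
      rw [hnorm D u h0]
      have : ∑ i, ((D i).1 ⬝ᵥ dir u) ^ 2 ≤ B * n := by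
        by_contra! hlt
        exact hDU u hu ⟨h0, hlt.le⟩
      calc _ ≤ 1 * √(B * n) := by gcongr; exact hS1 u hu
        _ = _ := one_mul _
    have hlow : ∀ u ∈ T, u ≠ 0 → √(τ * n) * ‖u‖ ≤ ‖designCLM D u‖ := fun u hu h0 => by
      rw [hnorm D u h0, mul_comm]
      have : τ * n ≤ ∑ i, ((D i).1 ⬝ᵥ dir u) ^ 2 := by
        by_contra! hlt
        exact hDV u hu ⟨h0, hlt.le⟩
      gcongr
    have hop := opNorm_le_of_half_net hS (designCLM D) (Real.sqrt_nonneg _) hup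
    have hfinal := le_norm_of_net (δ := (1 / 2) ^ (j + 1))
      (pow_le_of_le_one (by norm_num) (by norm_num) (Nat.succ_ne_zero j)) hT (designCLM D)
      (Real.sqrt_nonneg _) hlow (by
        calc (1 / 2 : ℝ) ^ (j + 1) * ‖designCLM D‖ ≤ (1 / 2) ^ (j + 1) * (2 * √(B * n)) := by gcongr
          _ = (1 / 2 : ℝ) ^ (j + 1) * (2 * √B) * √n := by
            rw [Real.sqrt_mul hB0.le]; ring
          _ ≤ √τ / 4 * √n := by gcongr
          _ = √(τ * n) / 4 := by rw [Real.sqrt_mul hτ0.le]; ring) (WithLp.toLp 2 v)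
    have hsq := pow_le_pow_left₀ (by positivity) hfinal 2
    rw [norm_designCLM_sq, mul_pow, EuclideanSpace.norm_sq_eq_dotProduct, div_pow,
      Real.sq_sqrt (by positivity)] at hsq
    have : τ * n / 4 ^ 2 * (v ⬝ᵥ v) = τ / 16 * n * (v ⬝ᵥ v) := by ring
    simp only [this] at hsq
    linarith
  have hcount : ∀ (W : Finset (EuclideanSpace ℝ ι)) (k : ℕ), k ≤ n → W.card ≤ 5 ^ k →
      (W.card : ℝ) * (1 / 10) ^ n ≤ (1 / 2) ^ n := fun W k hk hW => by
    have h1 : (W.card : ℝ) ≤ 5 ^ n := by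
      exact_mod_cast hW.trans (Nat.pow_le_pow_right (by norm_num) hk)
    calc _ ≤ (5 : ℝ) ^ n * (1 / 10) ^ n := by gcongr
      _ = _ := by rw [← mul_pow]; norm_num
  have hbu : ∀ (W : Finset (EuclideanSpace ℝ ι)) (G : EuclideanSpace ℝ ι → Set _),
      (∀ u, μ.real (G u) ≤ (1 / 10) ^ n) → μ.real (⋃ u ∈ W, G u) ≤ W.card * (1 / 10) ^ n :=
    fun W G hG => (measureReal_biUnion_finset_le W G).trans
      ((Finset.sum_le_card_nsmul W _ _ fun u _ => hG u).trans_eq (nsmul_eq_mul _ _))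
  calc _ ≤ μ.real ((⋃ u ∈ S, U u) ∪ ⋃ u ∈ T, V u) := measureReal_mono hsub
    _ ≤ μ.real (⋃ u ∈ S, U u) + μ.real (⋃ u ∈ T, V u) := measureReal_union_le _ _
    _ ≤ S.card * (1 / 10) ^ n + T.card * (1 / 10) ^ n := add_le_add (hbu S U hU) (hbu T V hV)
    _ ≤ (1 / 2) ^ n + (1 / 2) ^ n := by
      refine add_le_add (hcount S _ (le_trans ?_ hn') hScard) (hcount T _ hn' ?_)
      · exact Nat.le_mul_of_pos_left _ (Nat.succ_pos j)
      · rwa [← pow_mul, mul_comm] at hTcard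
    _ = _ := by ring

/-! ### Least squares on a fixed data set -/

namespace BlockMissing

section LeastSquares

variable {p n : ℕ} {O : Finset (Fin p)} (D : PatternData O n) (φ : {i // i ∈ O} → ℝ)

/-- The errors `yᵢ - xᵢᵀφ` of the linear predictor `φ`. -/
def residuals : Fin n → ℝ := fun i => (D i).2 - (D i).1 ⬝ᵥ φ

theorem design_mulVec_apply (v : {i // i ∈ O} → ℝ) (i : Fin n) :
    (design D *ᵥ v) i = (D i).1 ⬝ᵥ v := rfl

theorem sum_sq_residuals_sub (w : {i // i ∈ O} → ℝ) :
    ∑ i, (residuals D φ i - (D i).1 ⬝ᵥ w) ^ 2 =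
      ∑ i, residuals D φ i ^ 2 - 2 * (w ⬝ᵥ ((design D)ᵀ *ᵥ residuals D φ)) +
        ∑ i, ((D i).1 ⬝ᵥ w) ^ 2 := by
  have h : w ⬝ᵥ ((design D)ᵀ *ᵥ residuals D φ) = ∑ i, residuals D φ i * ((D i).1 ⬝ᵥ w) := by
    rw [Matrix.dotProduct_mulVec, Matrix.vecMul_transpose, dotProduct_comm]
    rfl
  rw [h, Finset.mul_sum, ← Finset.sum_sub_distrib, ← Finset.sum_add_distrib]
  exact Finset.sum_congr rfl fun i _ => by ring

theorem residualVar_eq : residualVar D =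
    1 / (n : ℝ) * ∑ i, (residuals D φ i - (D i).1 ⬝ᵥ (leastSquares D - φ)) ^ 2 := by
  unfold residualVar
  congr 1
  refine Finset.sum_congr rfl fun i _ => ?_
  rw [design_mulVec_apply, dotProduct_sub, residuals, response]
  ring

theorem dotProduct_gram_mulVec (v : {i // i ∈ O} → ℝ) :
    v ⬝ᵥ (((design D)ᵀ * design D) *ᵥ v) = ∑ i, ((D i).1 ⬝ᵥ v) ^ 2 := by
  rw [← Matrix.mulVec_mulVec, Matrix.dotProduct_mulVec, Matrix.vecMul_transpose]
  simp only [dotProduct, sq]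
  rfl

variable {D} {t : ℝ}

theorem isUnit_gram (ht : 0 < t) (hn : 0 < n)
    (hgram : ∀ v : {i // i ∈ O} → ℝ, t * n * (v ⬝ᵥ v) ≤ ∑ i, ((D i).1 ⬝ᵥ v) ^ 2) :
    IsUnit ((design D)ᵀ * design D) := by
  have hn' : (0 : ℝ) < n := by exact_mod_cast hn
  rw [← Matrix.mulVec_injective_iff_isUnit]
  refine (injective_iff_map_eq_zero ((design D)ᵀ * design D).mulVecLin).2 fun v hv => ?_
  rw [Matrix.mulVecLin_apply] at hv
  have h := hgram v
  rw [← dotProduct_gram_mulVec, hv, dotProduct_zero] at h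
  have h0 : 0 ≤ v ⬝ᵥ v := Finset.sum_nonneg fun j _ => mul_self_nonneg (v j)
  refine dotProduct_self_eq_zero.1 (le_antisymm ?_ h0)
  exact nonpos_of_mul_nonpos_right h (by positivity)

/-- The least squares fit does at least as well as any other linear predictor. -/
theorem residualVar_le (ht : 0 < t) (hn : 0 < n)
    (hgram : ∀ v : {i // i ∈ O} → ℝ, t * n * (v ⬝ᵥ v) ≤ ∑ i, ((D i).1 ⬝ᵥ v) ^ 2) :
    residualVar D ≤ 1 / (n : ℝ) * ∑ i, residuals D φ i ^ 2 := by
  set G := (design D)ᵀ * design D with hG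
  have hunit : IsUnit G.det := (Matrix.isUnit_iff_isUnit_det _).1 (isUnit_gram ht hn hgram)
  set w := leastSquares D - φ with hw
  have hnormal : (design D)ᵀ *ᵥ residuals D φ = G *ᵥ w := by
    have h1 : G *ᵥ leastSquares D = (design D)ᵀ *ᵥ response D := by
      rw [leastSquares, ← hG, Matrix.mulVec_mulVec, Matrix.mul_nonsing_inv _ hunit,
        Matrix.one_mulVec]
    have h2 : residuals D φ = response D - design D *ᵥ φ := rfl
    rw [h2, Matrix.mulVec_sub, ← h1, hw, Matrix.mulVec_sub, hG, Matrix.mulVec_mulVec]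
  rw [residualVar_eq D φ, sum_sq_residuals_sub, ← hw, hnormal, hG, dotProduct_gram_mulVec]
  have : 0 ≤ ∑ i, ((D i).1 ⬝ᵥ w) ^ 2 := Finset.sum_nonneg fun i _ => sq_nonneg _
  gcongr
  linarith

/-- Fitting reduces the residual sum of squares by at most `‖Xᵀη‖² / (t n)`, where `η` are the
errors of any predictor. -/
theorem le_residualVar (ht : 0 < t) (hn : 0 < n)
    (hgram : ∀ v : {i // i ∈ O} → ℝ, t * n * (v ⬝ᵥ v) ≤ ∑ i, ((D i).1 ⬝ᵥ v) ^ 2) :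
    1 / (n : ℝ) * (∑ i, residuals D φ i ^ 2 -
      (∑ j, ((design D)ᵀ *ᵥ residuals D φ) j ^ 2) / (t * n)) ≤ residualVar D := by
  have hn' : (0 : ℝ) < n := by exact_mod_cast hn
  rw [residualVar_eq D φ, sum_sq_residuals_sub]
  set w := leastSquares D - φ
  set W := (design D)ᵀ *ᵥ residuals D φ
  have hg := hgram w
  have hsq : 0 ≤ ∑ j, (t * n * w j - W j) ^ 2 := Finset.sum_nonneg fun j _ => sq_nonneg _
  have hexp : ∑ j, (t * n * w j - W j) ^ 2 =
      t * n * (t * n * (w ⬝ᵥ w) - 2 * (w ⬝ᵥ W)) + ∑ j, W j ^ 2 := by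
    simp only [dotProduct, Finset.mul_sum]
    rw [← Finset.sum_sub_distrib, Finset.mul_sum, ← Finset.sum_add_distrib]
    exact Finset.sum_congr rfl fun j _ => by ring
  have hdiv : -((∑ j, W j ^ 2) / (t * n)) ≤ t * n * (w ⬝ᵥ w) - 2 * (w ⬝ᵥ W) := by
    rw [← neg_div, div_le_iff₀ (by positivity)]
    linarith
  gcongr
  linarith

end LeastSquares

theorem measurable_residualVar {p n : ℕ} {O : Finset (Fin p)} :
    Measurable (residualVar : PatternData O n → ℝ) := by
  have hX : ∀ i j, Measurable fun D : PatternData O n => design D i j := fun i j => by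
    change Measurable fun D : PatternData O n => (D i).1 j
    fun_prop
  have hY : ∀ i, Measurable fun D : PatternData O n => response D i := fun i => by
    change Measurable fun D : PatternData O n => (D i).2
    fun_prop
  have hG : Measurable fun D : PatternData O n => fun j k => ((design D)ᵀ * design D) j k := by
    refine measurable_pi_lambda _ fun j => measurable_pi_lambda _ fun k => ?_
    simp only [Matrix.mul_apply, Matrix.transpose_apply]
    exact Finset.measurable_fun_sum _ fun i _ => (hX i j).mul (hX i k)
  have hadj : ∀ j k, Continuous fun A : {i // i ∈ O} → {i // i ∈ O} → ℝ =>
      (Matrix.of A).adjugate j k := fun j k => by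
    have : Continuous fun A : {i // i ∈ O} → {i // i ∈ O} → ℝ => (Matrix.of A).adjugate :=
      Continuous.matrix_adjugate continuous_id
    exact this.matrix_elem j k
  have hdet : Continuous fun A : {i // i ∈ O} → {i // i ∈ O} → ℝ => (Matrix.of A).det :=
    Continuous.matrix_det continuous_id
  have hinv : ∀ j k, Measurable fun D : PatternData O n =>
      ((design D)ᵀ * design D)⁻¹ j k := fun j k => by
    simp only [Matrix.inv_def, Matrix.smul_apply, smul_eq_mul, Ring.inverse_eq_inv']
    exact ((hdet.measurable.comp hG).inv).mul ((hadj j k).measurable.comp hG)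
  have hls : ∀ j, Measurable fun D : PatternData O n => leastSquares D j := fun j => by
    simp only [leastSquares, Matrix.mulVec, dotProduct, Matrix.transpose_apply]
    exact Finset.measurable_fun_sum _ fun k _ => (hinv j k).mul
      (Finset.measurable_fun_sum _ fun i _ => (hX i k).mul (hY i))
  unfold residualVar
  simp only [Matrix.mulVec, dotProduct]
  exact (Finset.measurable_fun_sum _ fun i _ => ((hY i).sub
    (Finset.measurable_fun_sum _ fun j _ => (hX i j).mul (hls j))).pow_const 2).const_mul _

end BlockMissing

/-! ### Concentration of the residual variance for one pattern -/

/-- Even moments of a sub-Gaussian variable. -/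
theorem integral_pow_le_of_integral_exp_sq_le {Ω : Type*} [MeasurableSpace Ω] {μ : Measure Ω}
    {f : Ω → ℝ} (hf : Measurable f) {c : ℝ} (hc : 0 < c)
    (hi : Integrable (fun ω => Real.exp (f ω ^ 2 / c ^ 2)) μ)
    (h2 : ∫ ω, Real.exp (f ω ^ 2 / c ^ 2) ∂μ ≤ 2) (k : ℕ) :
    Integrable (fun ω => f ω ^ (2 * k)) μ ∧
      ∫ ω, f ω ^ (2 * k) ∂μ ≤ 2 * k.factorial * c ^ (2 * k) := by
  have hpt : ∀ ω, f ω ^ (2 * k) ≤ k.factorial * c ^ (2 * k) * Real.exp (f ω ^ 2 / c ^ 2) := by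
    intro ω
    have h := Real.pow_div_factorial_le_exp (f ω ^ 2 / c ^ 2) (by positivity) k
    rw [div_le_iff₀ (by positivity), div_pow, div_le_iff₀ (by positivity), ← pow_mul,
      ← pow_mul] at h
    linarith
  have hint : Integrable (fun ω => f ω ^ (2 * k)) μ :=
    (hi.const_mul (k.factorial * c ^ (2 * k))).mono' (hf.pow_const _).aestronglyMeasurable
      (Filter.Eventually.of_forall fun ω => by
        rw [Real.norm_of_nonneg (by rw [pow_mul]; positivity)]
        exact hpt ω)
  refine ⟨hint, (integral_mono hint (hi.const_mul _) hpt).trans ?_⟩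
  rw [integral_const_mul]
  calc _ ≤ k.factorial * c ^ (2 * k) * 2 := by gcongr
    _ = _ := by ring

/-- Geometric decay beats the power `n ^ N`. -/
theorem half_pow_le_factorial_mul_div_pow (N n m : ℕ) (hm : 1 ≤ m) (hn : 0 < n) :
    (1 / 2 : ℝ) ^ n ≤ N.factorial * 2 ^ N * ((m : ℝ) / n) ^ N := by
  have hn' : (0 : ℝ) < n := by exact_mod_cast hn
  have hm' : (1 : ℝ) ≤ m := by exact_mod_cast hm
  have hexp : Real.exp ((n : ℝ) / 2) ≤ 2 ^ n := by
    have : Real.exp (1 / 2) ≤ 2 := by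
      rw [← Real.le_log_iff_exp_le (by norm_num)]
      linarith [Real.log_two_gt_d9]
    calc Real.exp ((n : ℝ) / 2) = Real.exp (1 / 2) ^ n := by rw [← Real.exp_nat_mul]; ring_nf
      _ ≤ 2 ^ n := by gcongr
  have h := (Real.pow_div_factorial_le_exp ((n : ℝ) / 2) (by positivity) N).trans hexp
  rw [div_le_iff₀ (by positivity), div_pow, div_le_iff₀ (by positivity)] at h
  calc (1 / 2 : ℝ) ^ n = 1 / 2 ^ n := by rw [div_pow, one_pow]
    _ ≤ N.factorial * 2 ^ N * (1 / n) ^ N := by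
      rw [div_pow, one_pow, mul_one_div, div_le_div_iff₀ (by positivity) (by positivity)]
      linarith
    _ ≤ _ := by gcongr

/-- Markov's inequality for a power. -/
theorem measureReal_ge_le_of_integral_pow {Ω : Type*} [MeasurableSpace Ω] {μ : Measure Ω}
    {f : Ω → ℝ} {N : ℕ} (hi : Integrable (fun ω => f ω ^ N) μ) (hf : ∀ ω, 0 ≤ f ω) {a b : ℝ} (ha : 0 < a)
    (h : ∫ ω, f ω ^ N ∂μ ≤ b * a ^ N) [IsFiniteMeasure μ] : μ.real {ω | a ≤ f ω} ≤ b := by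
  have h1 := mul_meas_ge_le_integral_of_nonneg (μ := μ)
    (Filter.Eventually.of_forall fun ω => pow_nonneg (hf ω) N) hi (a ^ N)
  have h2 : μ.real {ω | a ≤ f ω} ≤ μ.real {ω | a ^ N ≤ f ω ^ N} :=
    measureReal_mono fun ω (hω : a ≤ f ω) => pow_le_pow_left₀ ha.le hω N
  have h3 : 0 < a ^ N := by positivity
  have h4 := h1.trans h
  rw [mul_comm] at h4
  exact h2.trans (le_of_mul_le_mul_right h4 h3)

namespace BlockMissing

/-- `φ` is the population least squares coefficient of the law `Q` of `(x, y)`, its error has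
variance `d`, and the error has `4N`-th moment at most `M d ^ (2N)`. -/
structure ErrorMoments {ι : Type*} [Fintype ι] (Q : Measure ((ι → ℝ) × ℝ)) (φ : ι → ℝ) (d M : ℝ)
    (N : ℕ) : Prop where
  pos : 0 < d
  integrable : Integrable (fun z => (z.2 - z.1 ⬝ᵥ φ) ^ (2 * (2 * N))) Q
  orthogonal : ∀ j, ∫ z, z.1 j * (z.2 - z.1 ⬝ᵥ φ) ∂Q = 0
  variance : ∫ z, (z.2 - z.1 ⬝ᵥ φ) ^ 2 ∂Q = d
  moment : ∫ z, (z.2 - z.1 ⬝ᵥ φ) ^ (2 * (2 * N)) ∂Q ≤ M * d ^ (2 * N)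

namespace ErrorMoments

theorem measurable_error {ι : Type*} [Fintype ι] (φ : ι → ℝ) :
    Measurable fun z : (ι → ℝ) × ℝ => z.2 - z.1 ⬝ᵥ φ :=
  measurable_snd.sub (measurable_fst_dotProduct φ)

variable {ι : Type*} [Fintype ι] {Q : Measure ((ι → ℝ) × ℝ)} [IsProbabilityMeasure Q]
  {φ : ι → ℝ} {d M c s : ℝ} {N : ℕ}

/-- The mean squared error of `φ` on the sample concentrates around `d`. -/
theorem sum_sq_deviation (h : ErrorMoments Q φ d M N) (hM : 1 ≤ M) (hN : 1 ≤ N) {m n : ℕ}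
    (hm : 1 ≤ m) (hn : 0 < n) :
    (Measure.pi fun _ : Fin n => Q).real
      {D | n * d / 4 ≤ |∑ i, (((D i).2 - (D i).1 ⬝ᵥ φ) ^ 2 - d)|} ≤
        momentConst N * (128 * (M + 1)) ^ N * ((m : ℝ) / n) ^ N := by
  have hd := h.pos
  have hn' : (0 : ℝ) < n := by exact_mod_cast hn
  have hm' : (1 : ℝ) ≤ m := by exact_mod_cast hm
  have hK := momentConst_pos N
  set f : (ι → ℝ) × ℝ → ℝ := fun z => (z.2 - z.1 ⬝ᵥ φ) ^ 2 - d with hf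
  have hηm := measurable_error φ
  have hfm : Measurable f := (hηm.pow_const 2).sub_const d
  have hηLp := memLp_of_integrable_even_pow (N := 2 * N) (by omega)
    hηm.aestronglyMeasurable h.integrable
  have hi2 : Integrable (fun z : (ι → ℝ) × ℝ => (z.2 - z.1 ⬝ᵥ φ) ^ 2) Q :=
    hηLp.integrable_pow_of_le (by omega)
  have hpt : ∀ z, f z ^ (2 * N) ≤ 4 ^ N * ((z.2 - z.1 ⬝ᵥ φ) ^ (2 * (2 * N)) + d ^ (2 * N)) := by
    intro z
    have h1 : |f z| ≤ (z.2 - z.1 ⬝ᵥ φ) ^ 2 + d := by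
      refine (abs_sub _ _).trans_eq ?_
      rw [abs_of_nonneg (sq_nonneg _), abs_of_pos hd]
    calc f z ^ (2 * N) = |f z| ^ (2 * N) := ((even_two_mul N).pow_abs _).symm
      _ ≤ ((z.2 - z.1 ⬝ᵥ φ) ^ 2 + d) ^ (2 * N) := by gcongr
      _ ≤ 2 ^ (2 * N - 1) * (((z.2 - z.1 ⬝ᵥ φ) ^ 2) ^ (2 * N) + d ^ (2 * N)) :=
        add_pow_le (sq_nonneg _) hd.le _
      _ ≤ 2 ^ (2 * N) * (((z.2 - z.1 ⬝ᵥ φ) ^ 2) ^ (2 * N) + d ^ (2 * N)) := by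
        gcongr
        · norm_num
        · omega
      _ = _ := by
        rw [← pow_mul, pow_mul 2 2 N]
        norm_num
  have hbi : Integrable (fun z : (ι → ℝ) × ℝ =>
      4 ^ N * ((z.2 - z.1 ⬝ᵥ φ) ^ (2 * (2 * N)) + d ^ (2 * N))) Q :=
    (h.integrable.add (integrable_const _)).const_mul _
  have hfi : Integrable (fun z => f z ^ (2 * N)) Q :=
    hbi.mono' (hfm.pow_const _).aestronglyMeasurable (Filter.Eventually.of_forall fun z => by
      rw [Real.norm_of_nonneg (by rw [pow_mul]; positivity)]
      exact hpt z)
  have hmom : ∫ z, f z ^ (2 * N) ∂Q ≤ (4 * (M + 1) * d ^ 2) ^ N := by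
    have h1 := integral_mono hfi hbi hpt
    rw [integral_const_mul, integral_add h.integrable (integrable_const _)] at h1
    simp only [integral_const, probReal_univ, one_smul] at h1
    calc _ ≤ _ := h1
      _ ≤ 4 ^ N * (M * d ^ (2 * N) + d ^ (2 * N)) := by gcongr; exact h.moment
      _ = 4 ^ N * ((M + 1) ^ 1 * d ^ (2 * N)) := by ring
      _ ≤ 4 ^ N * ((M + 1) ^ N * d ^ (2 * N)) := by
        gcongr
        linarith
      _ = _ := by rw [mul_pow, mul_pow, ← pow_mul]; ring
  have hmean : ∫ z, f z ∂Q = 0 := by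
    rw [hf, integral_sub hi2 (integrable_const d), h.variance]
    simp
  obtain ⟨hSi, hS⟩ := integral_sample_sum_pow_le hfm hmean (by positivity)
    (memLp_of_integrable_even_pow (by omega) hfm.aestronglyMeasurable hfi) hmom n
  have habs : ∀ x : ℝ, |x| ^ (2 * N) = x ^ (2 * N) := fun x => (even_two_mul N).pow_abs x
  have hSi' : Integrable (fun D : Fin n → (ι → ℝ) × ℝ => |∑ i, f (D i)| ^ (2 * N))
      (Measure.pi fun _ => Q) := hSi.congr (Filter.Eventually.of_forall fun D => (habs _).symm)
  have hS' : ∫ D, |∑ i, f (D i)| ^ (2 * N) ∂(Measure.pi fun _ : Fin n => Q) ≤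
      momentConst N * (2 * (4 * (M + 1) * d ^ 2) * n) ^ N :=
    (integral_congr_ae (Filter.Eventually.of_forall fun D => habs _)).trans_le hS
  have ha : 0 < n * d / 4 := by positivity
  refine measureReal_ge_le_of_integral_pow hSi' (fun D => abs_nonneg _) ha (hS'.trans ?_)
  calc momentConst N * (2 * (4 * (M + 1) * d ^ 2) * n) ^ N
      = momentConst N * (128 * (M + 1)) ^ N * ((1 : ℝ) / n) ^ N * (n * d / 4) ^ (2 * N) := by
        have e : 2 * (4 * (M + 1) * d ^ 2) * n =
            128 * (M + 1) * (1 / n) * (n * d / 4) ^ 2 := by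
          field_simp
          norm_num
        rw [e, mul_pow, mul_pow _ (1 / (n : ℝ)), pow_mul _ 2 N]
        ring
    _ ≤ _ := by gcongr

/-- The score `Xᵀη` at the population coefficient has squared length of order `m n d` for a design
with `m` columns. -/
theorem score_deviation (h : ErrorMoments Q φ d M N) (hM : 1 ≤ M) (hN : 1 ≤ N)
    (hQ : DirectionBounds Q c s) (hc : 0 < c) {n : ℕ} (hn : 0 < n)
    (hm : 1 ≤ Fintype.card ι) {t : ℝ} (ht : 0 < t) :
    (Measure.pi fun _ : Fin n => Q).real
      {D | t * n ^ 2 * d / 4 ≤ ∑ j, (∑ i, (D i).1 j * ((D i).2 - (D i).1 ⬝ᵥ φ)) ^ 2} ≤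
        momentConst N * (8 * (2 * (2 * N).factorial * c ^ (2 * (2 * N)) + M) / t) ^ N *
          ((Fintype.card ι : ℝ) / n) ^ N := by
  classical
  have hd := h.pos
  have hn' : (0 : ℝ) < n := by exact_mod_cast hn
  have hK := momentConst_pos N
  set m := Fintype.card ι with hmdef
  set M₂ : ℝ := 2 * (2 * N).factorial * c ^ (2 * (2 * N)) + M with hM₂
  have hM₂1 : 1 ≤ M₂ := le_trans hM (le_add_of_nonneg_left (by positivity))
  set f : ι → (ι → ℝ) × ℝ → ℝ := fun j z => z.1 j * (z.2 - z.1 ⬝ᵥ φ) with hf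
  have hηm := measurable_error φ
  have hxm : ∀ j : ι, Measurable fun z : (ι → ℝ) × ℝ => z.1 j := fun j => by fun_prop
  have hfm : ∀ j, Measurable (f j) := fun j => (hxm j).mul hηm
  have hx : ∀ j : ι, Integrable (fun z : (ι → ℝ) × ℝ => z.1 j ^ (2 * (2 * N))) Q ∧
      ∫ z, z.1 j ^ (2 * (2 * N)) ∂Q ≤ 2 * (2 * N).factorial * c ^ (2 * (2 * N)) := fun j => by
    have hunit : (Pi.single j (1 : ℝ)) ⬝ᵥ (Pi.single j 1) = 1 := by simp
    have e : ∀ z : (ι → ℝ) × ℝ, z.1 ⬝ᵥ (Pi.single j (1 : ℝ)) = z.1 j := fun z => by simp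
    have h1 := hQ.integrable_exp _ hunit
    have h2 := hQ.integral_exp _ hunit
    simp only [e] at h1 h2
    exact integral_pow_le_of_integral_exp_sq_le (hxm j) hc h1 h2 (2 * N)
  have hpt : ∀ j z, f j z ^ (2 * N) ≤
      d ^ N * z.1 j ^ (2 * (2 * N)) + (z.2 - z.1 ⬝ᵥ φ) ^ (2 * (2 * N)) / d ^ N := by
    intro j z
    have hdN : 0 < d ^ N := by positivity
    set a := z.1 j ^ (2 * N)
    set b := (z.2 - z.1 ⬝ᵥ φ) ^ (2 * N)
    have ha : z.1 j ^ (2 * (2 * N)) = a ^ 2 := by rw [← pow_mul, mul_comm 2 (2 * N)]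
    have hb : (z.2 - z.1 ⬝ᵥ φ) ^ (2 * (2 * N)) = b ^ 2 := by rw [← pow_mul, mul_comm 2 (2 * N)]
    rw [hf, mul_pow, ha, hb]
    change a * b ≤ _
    have key : 0 ≤ (d ^ N * a - b) ^ 2 + (d ^ N * a) ^ 2 + b ^ 2 := by positivity
    have e : d ^ N * a ^ 2 + b ^ 2 / d ^ N - a * b =
        ((d ^ N * a - b) ^ 2 + (d ^ N * a) ^ 2 + b ^ 2) / (2 * d ^ N) := by
      field_simp
      ring
    have : 0 ≤ d ^ N * a ^ 2 + b ^ 2 / d ^ N - a * b := by rw [e]; positivity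
    linarith
  have hbi : ∀ j, Integrable (fun z : (ι → ℝ) × ℝ =>
      d ^ N * z.1 j ^ (2 * (2 * N)) + (z.2 - z.1 ⬝ᵥ φ) ^ (2 * (2 * N)) / d ^ N) Q := fun j =>
    ((hx j).1.const_mul _).add (h.integrable.div_const _)
  have hfi : ∀ j, Integrable (fun z => f j z ^ (2 * N)) Q := fun j =>
    (hbi j).mono' ((hfm j).pow_const _).aestronglyMeasurable
      (Filter.Eventually.of_forall fun z => by
        rw [Real.norm_of_nonneg (by rw [pow_mul]; positivity)]
        exact hpt j z)
  have hmom : ∀ j, ∫ z, f j z ^ (2 * N) ∂Q ≤ (M₂ * d) ^ N := fun j => by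
    have h1 := integral_mono (hfi j) (hbi j) (hpt j)
    rw [integral_add ((hx j).1.const_mul _) (h.integrable.div_const _), integral_const_mul,
      integral_div] at h1
    calc _ ≤ _ := h1
      _ ≤ d ^ N * (2 * (2 * N).factorial * c ^ (2 * (2 * N))) + M * d ^ (2 * N) / d ^ N := by
        gcongr
        · exact (hx j).2
        · exact h.moment
      _ = M₂ ^ 1 * d ^ N := by
        rw [hM₂]
        have : d ^ (2 * N) = d ^ N * d ^ N := by rw [two_mul, pow_add]
        rw [this]
        field_simp
      _ ≤ M₂ ^ N * d ^ N := by gcongr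
      _ = _ := (mul_pow _ _ _).symm
  have hW := fun j => integral_sample_sum_pow_le (hfm j) (h.orthogonal j) (by positivity)
    (memLp_of_integrable_even_pow (by omega) (hfm j).aestronglyMeasurable (hfi j)) (hmom j) n
  have hpow : ∀ D : Fin n → (ι → ℝ) × ℝ, (∑ j, (∑ i, f j (D i)) ^ 2) ^ N ≤
      (m : ℝ) ^ (N - 1) * ∑ j, (∑ i, f j (D i)) ^ (2 * N) := fun D => by
    obtain ⟨k, rfl⟩ : ∃ k, N = k + 1 := ⟨N - 1, by omega⟩
    have := pow_sum_div_card_le_sum_pow (s := Finset.univ)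
      (f := fun j => (∑ i, f j (D i)) ^ 2) (fun j _ => sq_nonneg _) k
    rw [div_le_iff₀ (by rw [Finset.card_univ]; positivity), Finset.card_univ] at this
    simp only [← pow_mul] at this
    rw [mul_comm]
    exact this
  have hSi : Integrable (fun D : Fin n → (ι → ℝ) × ℝ =>
      (m : ℝ) ^ (N - 1) * ∑ j, (∑ i, f j (D i)) ^ (2 * N)) (Measure.pi fun _ => Q) :=
    (integrable_finsetSum _ fun j _ => (hW j).1).const_mul _
  have hTm : Measurable fun D : Fin n → (ι → ℝ) × ℝ => (∑ j, (∑ i, f j (D i)) ^ 2) ^ N :=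
    (Finset.measurable_fun_sum _ fun j _ => (Finset.measurable_fun_sum _ fun i _ =>
      (hfm j).comp (measurable_pi_apply i)).pow_const 2).pow_const N
  have hTi : Integrable (fun D : Fin n → (ι → ℝ) × ℝ => (∑ j, (∑ i, f j (D i)) ^ 2) ^ N)
      (Measure.pi fun _ => Q) :=
    hSi.mono' hTm.aestronglyMeasurable (Filter.Eventually.of_forall fun D => by
      rw [Real.norm_of_nonneg (by positivity)]
      exact hpow D)
  refine measureReal_ge_le_of_integral_pow hTi (fun D => by positivity) (by positivity) ?_
  calc _ ≤ _ := integral_mono hTi hSi hpow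
    _ = (m : ℝ) ^ (N - 1) *
        ∑ j, ∫ D, (∑ i, f j (D i)) ^ (2 * N) ∂(Measure.pi fun _ : Fin n => Q) := by
      rw [integral_const_mul, integral_finsetSum _ fun j _ => (hW j).1]
    _ ≤ (m : ℝ) ^ (N - 1) * ∑ _j : ι, momentConst N * (2 * (M₂ * d) * n) ^ N := by
      gcongr with j
      exact (hW j).2
    _ = (m : ℝ) ^ N * (momentConst N * (2 * (M₂ * d) * n) ^ N) := by
      obtain ⟨k, rfl⟩ : ∃ k, N = k + 1 := ⟨N - 1, by omega⟩
      rw [Finset.sum_const, Finset.card_univ, nsmul_eq_mul, Nat.add_sub_cancel, pow_succ]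
      ring
    _ = momentConst N * (8 * M₂ / t) ^ N * ((m : ℝ) / n) ^ N * (t * n ^ 2 * d / 4) ^ N := by
      have e : (m : ℝ) * (2 * (M₂ * d) * n) = 8 * M₂ / t * (m / n) * (t * n ^ 2 * d / 4) := by
        field_simp
        norm_num
      rw [mul_left_comm, ← mul_pow, e, mul_pow, mul_pow]
      ring

end ErrorMoments

/-- The residual variance is within a factor two of the population error variance, outside an event
whose probability is of order `(m / n) ^ N`. The exceptional event is covered by three: the Gram
matrix is nearly singular, the mean squared error of `φ` is off by `d / 4`, or the score is so large
that fitting lowers the residual variance by `d / 4`. -/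
theorem exists_residualVar_deviation_bound {c s M : ℝ} (hc : 0 < c) (hs : 0 < s) (hM : 1 ≤ M)
    {N : ℕ} (hN : 1 ≤ N) :
    ∃ A F : ℝ, 1 ≤ A ∧ 0 < F ∧ ∀ (p n : ℕ) (O : Finset (Fin p))
      (Q : Measure (({i // i ∈ O} → ℝ) × ℝ)) [IsProbabilityMeasure Q] (φ : {i // i ∈ O} → ℝ)
      (d : ℝ), O.Nonempty → 0 < n → A * O.card ≤ n → DirectionBounds Q c s →
        ErrorMoments Q φ d M N →
        (Measure.pi fun _ : Fin n => Q).real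
          {D : PatternData O n | ¬ (d / 2 ≤ residualVar D ∧ residualVar D ≤ 2 * d)} ≤
            F * ((O.card : ℝ) / n) ^ N := by
  obtain ⟨t, A, ht, hA, hsing⟩ := exists_smallest_singular_value_bound hc hs
  have hK := momentConst_pos N
  refine ⟨A, 2 * (N.factorial * 2 ^ N) + momentConst N * (128 * (M + 1)) ^ N +
    momentConst N * (8 * (2 * (2 * N).factorial * c ^ (2 * (2 * N)) + M) / t) ^ N, hA,
    by positivity, fun p n O Q _ φ d hO hn hAn hQ hE => ?_⟩
  have hcard : Fintype.card {i // i ∈ O} = O.card := Fintype.card_coe O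
  have hm : 1 ≤ O.card := hO.card_pos
  have hd := hE.pos
  have hn' : (0 : ℝ) < n := by exact_mod_cast hn
  have h1 := hsing {i // i ∈ O} Q hQ n (by rwa [hcard])
  have h2 := hE.sum_sq_deviation hM hN hm hn
  have h3 := hE.score_deviation hM hN hQ hc hn (by rwa [hcard]) ht
  rw [hcard] at h3
  have h4 := half_pow_le_factorial_mul_div_pow N n O.card hm hn
  set μ := Measure.pi fun _ : Fin n => Q
  set E₁ := {D : Fin n → ({i // i ∈ O} → ℝ) × ℝ |
    ∃ v : {i // i ∈ O} → ℝ, ∑ i, ((D i).1 ⬝ᵥ v) ^ 2 < t * n * (v ⬝ᵥ v)} with hE₁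
  set E₂ := {D : Fin n → ({i // i ∈ O} → ℝ) × ℝ |
    n * d / 4 ≤ |∑ i, (((D i).2 - (D i).1 ⬝ᵥ φ) ^ 2 - d)|} with hE₂
  set E₃ := {D : Fin n → ({i // i ∈ O} → ℝ) × ℝ |
    t * n ^ 2 * d / 4 ≤ ∑ j, (∑ i, (D i).1 j * ((D i).2 - (D i).1 ⬝ᵥ φ)) ^ 2} with hE₃
  have hsub : {D : PatternData O n | ¬ (d / 2 ≤ residualVar D ∧ residualVar D ≤ 2 * d)} ⊆
      E₁ ∪ E₂ ∪ E₃ := by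
    -- off `E₁` the Gram matrix is invertible, so the matrix inverse in `leastSquares` is a true one
    intro D hD
    by_contra hgood
    simp only [Set.mem_union, not_or] at hgood
    obtain ⟨⟨hg1, hg2⟩, hg3⟩ := hgood
    have hgram : ∀ v : {i // i ∈ O} → ℝ, t * n * (v ⬝ᵥ v) ≤ ∑ i, ((D i).1 ⬝ᵥ v) ^ 2 := fun v => by
      by_contra! hlt
      exact hg1 ⟨v, hlt⟩
    have hT : |∑ i, residuals D φ i ^ 2 - n * d| < n * d / 4 := by
      have : ∑ i, (((D i).2 - (D i).1 ⬝ᵥ φ) ^ 2 - d) = ∑ i, residuals D φ i ^ 2 - n * d := by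
        rw [Finset.sum_sub_distrib]
        simp [residuals]
      rw [← this]
      exact not_le.1 hg2
    have hW : ∑ j, ((design D)ᵀ *ᵥ residuals D φ) j ^ 2 < t * n ^ 2 * d / 4 := not_le.1 hg3
    obtain ⟨hT1, hT2⟩ := abs_lt.1 hT
    have hup := residualVar_le φ ht hn hgram
    have hlow := le_residualVar φ ht hn hgram
    have hWdiv : (∑ j, ((design D)ᵀ *ᵥ residuals D φ) j ^ 2) / (t * n) ≤ n * d / 4 := by
      rw [div_le_iff₀ (by positivity)]
      refine hW.le.trans_eq ?_
      ring
    refine hD ⟨le_trans ?_ hlow, hup.trans ?_⟩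
    · rw [one_div, ← div_eq_inv_mul, le_div_iff₀ hn']
      linarith
    · rw [one_div, ← div_eq_inv_mul, div_le_iff₀ hn']
      nlinarith
  calc _ ≤ μ.real (E₁ ∪ E₂ ∪ E₃) := measureReal_mono hsub
    _ ≤ μ.real E₁ + μ.real E₂ + μ.real E₃ :=
      (measureReal_union_le _ _).trans (by gcongr; exact measureReal_union_le _ _)
    _ ≤ 2 * (N.factorial * 2 ^ N * ((O.card : ℝ) / n) ^ N) + _ + _ :=
      add_le_add (add_le_add (h1.trans (by gcongr)) h2) h3
    _ = _ := by ring

end BlockMissing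

/-! ### The population regression on the observed covariates -/

/-- A symmetric matrix with spectrum above `a` has quadratic form at least `a ‖u‖²`. -/
theorem Matrix.IsHermitian.mul_dotProduct_le_of_spectrum {ι : Type*} [Fintype ι] [DecidableEq ι]
    {S : Matrix ι ι ℝ} (hS : S.IsHermitian) {a b : ℝ} (h : spectrum ℝ S ⊆ Set.Icc a b)
    (u : ι → ℝ) : a * (u ⬝ᵥ u) ≤ u ⬝ᵥ (S *ᵥ u) := by
  have hT : (S - algebraMap ℝ (Matrix ι ι ℝ) a).IsHermitian := by
    refine hS.sub ?_
    rw [Matrix.algebraMap_eq_diagonal]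
    exact Matrix.isHermitian_diagonal _
  have hpos : (S - algebraMap ℝ (Matrix ι ι ℝ) a).PosSemidef := by
    rw [hT.posSemidef_iff_eigenvalues_nonneg]
    intro i
    have h1 := hT.eigenvalues_mem_spectrum_real i
    rw [← spectrum.sub_singleton_eq, Set.mem_sub] at h1
    obtain ⟨x, hx, y, hy, hxy⟩ := h1
    rw [Set.mem_singleton_iff] at hy
    have := (h hx).1
    simp only [Pi.zero_apply]
    linarith
  have h2 := hpos.dotProduct_mulVec_nonneg u
  rw [star_trivial, Matrix.sub_mulVec, dotProduct_sub, Algebra.algebraMap_eq_smul_one,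
    Matrix.smul_mulVec, Matrix.one_mulVec, dotProduct_smul, smul_eq_mul] at h2
  linarith

namespace BlockMissing

/-- Extension by zero of a vector indexed by the observed coordinates. -/
def extendZero {p : ℕ} {O : Finset (Fin p)} (v : {i // i ∈ O} → ℝ) : Fin p → ℝ :=
  fun i => if h : i ∈ O then v ⟨i, h⟩ else 0

theorem sum_split {p : ℕ} (O : Finset (Fin p)) (f : Fin p → ℝ) :
    ∑ i, f i = ∑ i : {i // i ∈ O}, f i + ∑ i : {i // i ∈ Oᶜ}, f i := by
  rw [Finset.sum_coe_sort O f, Finset.sum_coe_sort Oᶜ f, Finset.sum_add_sum_compl]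

theorem dotProduct_extendZero {p : ℕ} {O : Finset (Fin p)} (x : Fin p → ℝ)
    (v : {i // i ∈ O} → ℝ) : x ⬝ᵥ extendZero v = (fun i : {i // i ∈ O} => x i) ⬝ᵥ v := by
  have h1 : ∀ i : {i // i ∈ O}, extendZero v i = v i := fun i => by simp [extendZero]
  have h2 : ∀ i : {i // i ∈ Oᶜ}, extendZero v i = 0 := fun i => by
    have := Finset.mem_compl.1 i.2
    simp [extendZero, this]
  simp only [dotProduct]
  rw [sum_split O]
  simp [h1, h2]

theorem extendZero_dotProduct_self {p : ℕ} {O : Finset (Fin p)} (v : {i // i ∈ O} → ℝ) :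
    extendZero v ⬝ᵥ extendZero v = v ⬝ᵥ v := by
  rw [dotProduct_extendZero]
  congr 1
  ext i
  simp [extendZero]

/-- The vector `θ` that agrees with `β` on the missing coordinates and whose image under `S`
vanishes on the observed ones has energy `β_Mᵀ S_M β_M`. In the linear model `Xᵀθ` is the part of
the signal `Xᵀβ` that is not explained linearly by the observed covariates. -/
theorem exists_unexplained_direction {p : ℕ} {S : Matrix (Fin p) (Fin p) ℝ} {a : ℝ} (ha : 0 < a)
    (hS : ∀ u : Fin p → ℝ, a * (u ⬝ᵥ u) ≤ u ⬝ᵥ (S *ᵥ u)) (O : Finset (Fin p)) (β : Fin p → ℝ) :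
    ∃ θ : Fin p → ℝ, (∀ i, i ∉ O → θ i = β i) ∧ (∀ j ∈ O, (S *ᵥ θ) j = 0) ∧
      θ ⬝ᵥ (S *ᵥ θ) = (fun i : {i // i ∈ Oᶜ} => β i) ⬝ᵥ (schur S O *ᵥ fun i => β i) := by
  set Soo := S.submatrix ((↑) : {i // i ∈ O} → Fin p) ((↑) : {i // i ∈ O} → Fin p) with hSoo
  set Som := S.submatrix ((↑) : {i // i ∈ O} → Fin p) ((↑) : {i // i ∈ Oᶜ} → Fin p) with hSom
  set Smo := S.submatrix ((↑) : {i // i ∈ Oᶜ} → Fin p) ((↑) : {i // i ∈ O} → Fin p) with hSmo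
  set Smm := S.submatrix ((↑) : {i // i ∈ Oᶜ} → Fin p) ((↑) : {i // i ∈ Oᶜ} → Fin p) with hSmm
  set βM : {i // i ∈ Oᶜ} → ℝ := fun i => β i with hβM
  have hunit : IsUnit Soo := by
    rw [← Matrix.mulVec_injective_iff_isUnit]
    refine (injective_iff_map_eq_zero Soo.mulVecLin).2 fun v hv => ?_
    rw [Matrix.mulVecLin_apply] at hv
    have h := hS (extendZero v)
    have h1 : extendZero v ⬝ᵥ (S *ᵥ extendZero v) = v ⬝ᵥ (Soo *ᵥ v) := by
      rw [dotProduct_comm, dotProduct_extendZero, dotProduct_comm]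
      congr 1
      ext i
      exact dotProduct_extendZero _ v
    rw [h1, hv, dotProduct_zero, extendZero_dotProduct_self] at h
    have h0 : 0 ≤ v ⬝ᵥ v := Finset.sum_nonneg fun j _ => mul_self_nonneg (v j)
    exact dotProduct_self_eq_zero.1 (le_antisymm (nonpos_of_mul_nonpos_right h ha) h0)
  have hdet : IsUnit Soo.det := (Matrix.isUnit_iff_isUnit_det _).1 hunit
  set w : {i // i ∈ O} → ℝ := -(Soo⁻¹ *ᵥ (Som *ᵥ βM)) with hw
  set θ : Fin p → ℝ := fun i => if h : i ∈ O then w ⟨i, h⟩ else β i with hθ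
  have hθO : ∀ i : {i // i ∈ O}, θ i = w i := fun i => by simp [hθ]
  have hθM : ∀ i : {i // i ∈ Oᶜ}, θ i = β i := fun i => by
    have := Finset.mem_compl.1 i.2
    simp [hθ, this]
  have hmul : ∀ j, (S *ᵥ θ) j = ∑ i : {i // i ∈ O}, S j i * w i +
      ∑ i : {i // i ∈ Oᶜ}, S j i * β i := fun j => by
    simp only [Matrix.mulVec, dotProduct]
    rw [sum_split O]
    simp only [hθO, hθM]
  have hO : ∀ j : {i // i ∈ O}, (S *ᵥ θ) j = 0 := fun j => by
    have h1 : (S *ᵥ θ) j = (Soo *ᵥ w + Som *ᵥ βM) j := hmul j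
    rw [h1, hw, Matrix.mulVec_neg, Matrix.mulVec_mulVec, Matrix.mul_nonsing_inv _ hdet,
      Matrix.one_mulVec, neg_add_cancel, Pi.zero_apply]
  have hM : ∀ j : {i // i ∈ Oᶜ}, (S *ᵥ θ) j = (schur S O *ᵥ βM) j := fun j => by
    have h1 : (S *ᵥ θ) j = (Smo *ᵥ w + Smm *ᵥ βM) j := hmul j
    have h2 : schur S O = Smm - Smo * Soo⁻¹ * Som := rfl
    rw [h1, h2, hw, Matrix.sub_mulVec, Matrix.mulVec_neg, ← Matrix.mulVec_mulVec,
      ← Matrix.mulVec_mulVec, neg_add_eq_sub]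
  refine ⟨θ, fun i hi => hθM ⟨i, Finset.mem_compl.2 hi⟩, fun j hj => hO ⟨j, hj⟩, ?_⟩
  simp only [dotProduct]
  rw [sum_split O]
  simp only [hO, hM, hθM, mul_zero, Finset.sum_const_zero, zero_add]
  rfl

end BlockMissing

/-! ### Moments in the linear model -/

namespace BlockMissing

/-- The map `(x, y) ↦ (x_O, y)` that forgets the missing covariates. -/
def observe {p : ℕ} (O : Finset (Fin p)) (z : (Fin p → ℝ) × ℝ) : ({i // i ∈ O} → ℝ) × ℝ :=
  (fun i => z.1 i, z.2)

theorem measurable_observe {p : ℕ} (O : Finset (Fin p)) : Measurable (observe O) := by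
  unfold observe; fun_prop

theorem isProbabilityMeasure_observedLaw {p : ℕ} (P : Measure ((Fin p → ℝ) × ℝ))
    [IsProbabilityMeasure P] (O : Finset (Fin p)) : IsProbabilityMeasure (observedLaw P O) :=
  Measure.isProbabilityMeasure_map (measurable_observe O).aemeasurable

theorem integral_observedLaw {p : ℕ} (P : Measure ((Fin p → ℝ) × ℝ)) (O : Finset (Fin p))
    {f : ({i // i ∈ O} → ℝ) × ℝ → ℝ} (hf : Measurable f) :
    ∫ z, f z ∂(observedLaw P O) = ∫ z, f (observe O z) ∂P :=
  integral_map (measurable_observe O).aemeasurable hf.aestronglyMeasurable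

theorem integrable_observedLaw {p : ℕ} (P : Measure ((Fin p → ℝ) × ℝ)) (O : Finset (Fin p))
    {f : ({i // i ∈ O} → ℝ) × ℝ → ℝ} (hf : Measurable f) :
    Integrable f (observedLaw P O) ↔ Integrable (fun z => f (observe O z)) P :=
  integrable_map_measure hf.aestronglyMeasurable (measurable_observe O).aemeasurable

/-- A bound on the `ψ₂` norm makes the exponential moment finite at any larger scale. -/
theorem exp_sq_moment_of_psi2Norm_le {Ω : Type*} [MeasurableSpace Ω] {μ : Measure Ω} {f : Ω → ℝ}
    (hf : Measurable f) {a c : ℝ} (ha : 0 < a) (hac : a < c)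
    (h : psi2Norm μ f ≤ ENNReal.ofReal a) :
    Integrable (fun ω => Real.exp (f ω ^ 2 / c ^ 2)) μ ∧
      ∫ ω, Real.exp (f ω ^ 2 / c ^ 2) ∂μ ≤ 2 := by
  have hlt : psi2Norm μ f < ENNReal.ofReal c :=
    h.trans_lt ((ENNReal.ofReal_lt_ofReal_iff (ha.trans hac)).2 hac)
  simp only [psi2Norm, iInf_lt_iff] at hlt
  obtain ⟨b, ⟨hb, hb2⟩, hbc⟩ := hlt
  have hbc' : b < c := (ENNReal.ofReal_lt_ofReal_iff (ha.trans hac)).1 hbc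
  have hle : ∫⁻ ω, ENNReal.ofReal (Real.exp (f ω ^ 2 / c ^ 2)) ∂μ ≤ 2 := by
    refine (lintegral_mono fun ω => ENNReal.ofReal_le_ofReal (Real.exp_le_exp.2 ?_)).trans hb2
    gcongr
  have hm : AEStronglyMeasurable (fun ω => Real.exp (f ω ^ 2 / c ^ 2)) μ :=
    ((hf.pow_const 2).div_const _).exp.aestronglyMeasurable
  have h0 : 0 ≤ᵐ[μ] fun ω => Real.exp (f ω ^ 2 / c ^ 2) :=
    Filter.Eventually.of_forall fun ω => (Real.exp_pos _).le
  refine ⟨(lintegral_ofReal_ne_top_iff_integrable hm h0).1 (hle.trans_lt (by simp)).ne, ?_⟩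
  rw [integral_eq_lintegral_of_nonneg_ae h0 hm]
  exact ENNReal.toReal_le_of_le_ofReal (by norm_num) (by simpa using hle)

theorem exp_sq_moment_direction {p : ℕ} {P : Measure ((Fin p → ℝ) × ℝ)} {CX : ℝ} (hCX : 0 < CX)
    (h : covariatePsi2Norm P ≤ ENNReal.ofReal CX) {u : Fin p → ℝ} (hu : u ⬝ᵥ u = 1) :
    Integrable (fun z => Real.exp ((z.1 ⬝ᵥ u) ^ 2 / (2 * CX) ^ 2)) P ∧
      ∫ z, Real.exp ((z.1 ⬝ᵥ u) ^ 2 / (2 * CX) ^ 2) ∂P ≤ 2 := by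
  refine exp_sq_moment_of_psi2Norm_le (measurable_fst_dotProduct u) hCX (by linarith)
    (le_trans ?_ h)
  exact le_iSup₂ (f := fun (u : Fin p → ℝ) (_ : u ⬝ᵥ u = 1) => psi2Norm P fun z => z.1 ⬝ᵥ u) u hu

/-- The observed covariates inherit the sub-Gaussian and small-ball bounds; the small-ball scale is
the one at which `(C t) ^ χ = 1 / 60`. -/
theorem directionBounds_observedLaw {p : ℕ} {P : Measure ((Fin p → ℝ) × ℝ)} {CX C χ lam : ℝ}
    [IsFiniteMeasure P] (hCX : 0 < CX) (hC : 0 < C) (hχ : 0 < χ)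
    (hψ : covariatePsi2Norm P ≤ ENNReal.ofReal CX) (hball : SmallBall P C χ)
    (hS : ∀ u : Fin p → ℝ, lam * (u ⬝ᵥ u) ≤ u ⬝ᵥ (secondMoment P *ᵥ u)) (O : Finset (Fin p)) :
    DirectionBounds (observedLaw P O) (2 * CX) ((1 / 60) ^ (1 / χ) / C * √lam) := by
  have hobs : ∀ (v : {i // i ∈ O} → ℝ) (z : (Fin p → ℝ) × ℝ),
      (observe O z).1 ⬝ᵥ v = z.1 ⬝ᵥ extendZero v := fun v z => (dotProduct_extendZero z.1 v).symm
  have hmexp : ∀ v : {i // i ∈ O} → ℝ, Measurable fun z : ({i // i ∈ O} → ℝ) × ℝ =>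
      Real.exp ((z.1 ⬝ᵥ v) ^ 2 / (2 * CX) ^ 2) := fun v =>
    (((measurable_fst_dotProduct v).pow_const 2).div_const _).exp
  have hunit : ∀ v : {i // i ∈ O} → ℝ, v ⬝ᵥ v = 1 → extendZero v ⬝ᵥ extendZero v = 1 :=
    fun v hv => by rw [extendZero_dotProduct_self, hv]
  refine ⟨fun v hv => ?_, fun v hv => ?_, fun v hv => ?_⟩
  · rw [integrable_observedLaw P O (hmexp v)]
    simp only [hobs]
    exact (exp_sq_moment_direction hCX hψ (hunit v hv)).1
  · rw [integral_observedLaw P O (hmexp v)]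
    simp only [hobs]
    exact (exp_sq_moment_direction hCX hψ (hunit v hv)).2
  · set t := (1 / 60 : ℝ) ^ (1 / χ) / C with ht
    have ht0 : 0 < t := by positivity
    have hset : MeasurableSet {z : ({i // i ∈ O} → ℝ) × ℝ | |z.1 ⬝ᵥ v| ≤ t * √lam} :=
      measurableSet_le (by simpa [Real.norm_eq_abs] using (measurable_fst_dotProduct v).norm)
        measurable_const
    have hne : extendZero v ≠ 0 := fun h => by
      have := hunit v hv
      rw [h] at this
      simp at this
    have hb := hball (extendZero v) hne t ht0
    have hCt : (C * t) ^ χ = 1 / 60 := by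
      rw [ht, mul_div_cancel₀ _ hC.ne', ← Real.rpow_mul (by norm_num), one_div_mul_cancel hχ.ne',
        Real.rpow_one]
    rw [hCt] at hb
    refine le_trans ?_ hb
    change (P.map (observe O)).real _ ≤ _
    rw [map_measureReal_apply (measurable_observe O) hset]
    refine measureReal_mono fun z (hz : |(observe O z).1 ⬝ᵥ v| ≤ t * √lam) => ?_
    rw [hobs] at hz
    refine hz.trans ?_
    have := hS (extendZero v)
    rw [hunit v hv, mul_one] at this
    gcongr

section LinearModel

variable {p : ℕ} {P : Measure ((Fin p → ℝ) × ℝ)} {β : Fin p → ℝ} {σ : ℝ}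

theorem measurable_noise (β : Fin p → ℝ) : Measurable (noise β) :=
  measurable_snd.sub (measurable_fst_dotProduct β)

theorem secondMoment_isHermitian (P : Measure ((Fin p → ℝ) × ℝ)) :
    (secondMoment P).IsHermitian := by
  ext i j
  simp [secondMoment, mul_comm]

namespace IsLinearModel

variable (h : IsLinearModel P β σ)
include h

theorem integrable_mul_covariate (i j : Fin p) : Integrable (fun z => z.1 i * z.1 j) P :=
  (h.covariate_memLp i).integrable_mul (h.covariate_memLp j)

theorem memLp_dotProduct (u : Fin p → ℝ) : MemLp (fun z => z.1 ⬝ᵥ u) 2 P :=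
  memLp_finsetSum Finset.univ fun i _ => (h.covariate_memLp i).mul_const (u i)

theorem integrable_mul_dotProduct (u : Fin p → ℝ) (j : Fin p) :
    Integrable (fun z => z.1 j * (z.1 ⬝ᵥ u)) P :=
  (h.covariate_memLp j).integrable_mul (h.memLp_dotProduct u)

theorem integral_mul_dotProduct (u : Fin p → ℝ) (j : Fin p) :
    ∫ z, z.1 j * (z.1 ⬝ᵥ u) ∂P = (secondMoment P *ᵥ u) j := by
  simp only [Matrix.mulVec, dotProduct, Finset.mul_sum, secondMoment, Matrix.of_apply, ← mul_assoc]
  rw [integral_finsetSum _ fun i _ => (h.integrable_mul_covariate j i).mul_const _]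
  simp only [integral_mul_const]

theorem integral_dotProduct_sq (u : Fin p → ℝ) :
    ∫ z, (z.1 ⬝ᵥ u) ^ 2 ∂P = u ⬝ᵥ (secondMoment P *ᵥ u) := by
  have e : ∀ z : (Fin p → ℝ) × ℝ, (z.1 ⬝ᵥ u) ^ 2 = ∑ j, u j * (z.1 j * (z.1 ⬝ᵥ u)) := fun z => by
    rw [sq]
    nth_rewrite 1 [dotProduct]
    rw [Finset.sum_mul]
    exact Finset.sum_congr rfl fun j _ => by ring
  simp only [e]
  rw [integral_finsetSum _ fun j _ =>
    (h.integrable_mul_dotProduct u j).const_mul _]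
  simp only [integral_const_mul, h.integral_mul_dotProduct]
  rfl

theorem integrable_noise_mul (j : Fin p) : Integrable (fun z => z.1 j * noise β z) P :=
  (h.covariate_memLp j).integrable_mul h.noise_memLp

/-- The noise is uncorrelated with the covariates. -/
theorem integral_covariate_mul_noise (j : Fin p) : ∫ z, z.1 j * noise β z ∂P = 0 := by
  have := h.isProb
  have hm : covariateSigma p ≤ Prod.instMeasurableSpace := measurable_fst.comap_le
  have hxm : StronglyMeasurable[covariateSigma p] fun z : (Fin p → ℝ) × ℝ => z.1 j :=
    ((measurable_pi_apply j).comp (comap_measurable Prod.fst)).stronglyMeasurable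
  have hpull := condExp_mul_of_stronglyMeasurable_left hxm (h.integrable_noise_mul j)
    (h.noise_memLp.integrable (by norm_num))
  have h1 := integral_condExp (μ := P) (f := (fun z : (Fin p → ℝ) × ℝ => z.1 j) * noise β) hm
  have h2 : ∫ z, P[(fun z : (Fin p → ℝ) × ℝ => z.1 j) * noise β | covariateSigma p] z ∂P = 0 := by
    refine integral_eq_zero_of_ae ?_
    filter_upwards [hpull, h.condExp_noise] with z hz hz2
    rw [hz, Pi.mul_apply, hz2]
    simp
  exact h1.symm.trans h2

theorem integral_noise_sq : ∫ z, noise β z ^ 2 ∂P = σ ^ 2 := by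
  have := h.isProb
  have hm : covariateSigma p ≤ Prod.instMeasurableSpace := measurable_fst.comap_le
  have h1 := integral_condExp (μ := P)
    (f := (noise β - P[noise β | covariateSigma p]) ^ 2) hm
  have h2 : ∫ z, P[(noise β - P[noise β | covariateSigma p]) ^ 2 | covariateSigma p] z ∂P =
      σ ^ 2 := by
    have := integral_congr_ae h.condVar_noise
    simp only [integral_const, probReal_univ, one_smul] at this
    exact this
  rw [← h2, h1]
  refine integral_congr_ae ?_
  filter_upwards [h.condExp_noise] with z hz
  simp [hz]

/-- For a vector `θ` the variable `ε + Xᵀθ` has variance `σ² + θᵀΣθ`. -/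
theorem integral_noise_add_sq (θ : Fin p → ℝ) :
    ∫ z, (noise β z + z.1 ⬝ᵥ θ) ^ 2 ∂P = σ ^ 2 + θ ⬝ᵥ (secondMoment P *ᵥ θ) := by
  have i1 := h.noise_memLp.integrable_sq
  have i2 := (h.memLp_dotProduct θ).integrable_sq
  have e : ∀ z : (Fin p → ℝ) × ℝ, (noise β z + z.1 ⬝ᵥ θ) ^ 2 =
      noise β z ^ 2 + (z.1 ⬝ᵥ θ) ^ 2 + ∑ j, 2 * θ j * (z.1 j * noise β z) := fun z => by
    have : ∑ j, 2 * θ j * (z.1 j * noise β z) = 2 * noise β z * (z.1 ⬝ᵥ θ) := by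
      rw [dotProduct, Finset.mul_sum]
      exact Finset.sum_congr rfl fun j _ => by ring
    rw [this]; ring
  have i3 : ∀ j ∈ Finset.univ, Integrable (fun z => 2 * θ j * (z.1 j * noise β z)) P :=
    fun j _ => (h.integrable_noise_mul j).const_mul _
  have h1 := integral_add (i1.add i2) (integrable_finsetSum _ i3)
  have h2 := integral_add i1 i2
  simp only [Pi.add_apply] at h1 h2
  simp only [e]
  rw [h1, h2, integral_finsetSum _ i3, h.integral_noise_sq, h.integral_dotProduct_sq]
  simp [integral_const_mul, h.integral_covariate_mul_noise]

end IsLinearModel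

end LinearModel

/-- Passing from the real moment of order `8q` to the integral one of order `4N ≤ 8q`. -/
theorem integral_pow_le_of_rpow_moment {Ω : Type*} [MeasurableSpace Ω] {μ : Measure Ω}
    [IsProbabilityMeasure μ] {f : Ω → ℝ} (hf : Measurable f) {q a : ℝ} {N : ℕ} (hq : 0 < q)
    (hNq : (N : ℝ) ≤ 2 * q) (ha : 0 < a) (hi : Integrable (fun ω => |f ω| ^ (8 * q)) μ)
    (h : (∫ ω, |f ω| ^ (8 * q) ∂μ) ^ (1 / (4 * q)) ≤ a) :
    Integrable (fun ω => f ω ^ (2 * (2 * N))) μ ∧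
      ∫ ω, f ω ^ (2 * (2 * N)) ∂μ ≤ 2 * a ^ (2 * N) := by
  have hI0 : 0 ≤ ∫ ω, |f ω| ^ (8 * q) ∂μ := integral_nonneg fun ω => by positivity
  have hI : ∫ ω, |f ω| ^ (8 * q) ∂μ ≤ a ^ (4 * q) := by
    have := Real.rpow_le_rpow (by positivity) h (by positivity : 0 ≤ 4 * q)
    rwa [← Real.rpow_mul hI0, one_div_mul_cancel (by positivity), Real.rpow_one] at this
  have hpt : ∀ ω, f ω ^ (2 * (2 * N)) ≤ a ^ (2 * N) * (1 + |f ω| ^ (8 * q) / a ^ (4 * q)) := by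
    intro ω
    set y := |f ω| / √a with hy
    have hsa : 0 < √a := Real.sqrt_pos.2 ha
    have hy0 : 0 ≤ y := by positivity
    have hfy : |f ω| = √a * y := by rw [hy, mul_div_cancel₀ _ hsa.ne']
    have e1 : f ω ^ (2 * (2 * N)) = a ^ (2 * N) * y ^ (2 * (2 * N)) := by
      have : f ω ^ (2 * (2 * N)) = |f ω| ^ (2 * (2 * N)) :=
        ((even_two_mul _).pow_abs _).symm
      rw [this, hfy, mul_pow, pow_mul (√a), Real.sq_sqrt ha.le]
    have e2 : |f ω| ^ (8 * q) = a ^ (4 * q) * y ^ (8 * q) := by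
      rw [hfy, Real.mul_rpow hsa.le hy0, Real.sqrt_eq_rpow, ← Real.rpow_mul ha.le]
      congr 2
      ring
    rw [e1, e2, mul_div_cancel_left₀ _ (by positivity)]
    gcongr
    rcases le_total y 1 with h1 | h1
    · exact (pow_le_one₀ hy0 h1).trans (le_add_of_nonneg_right (by positivity))
    · refine le_trans ?_ (le_add_of_nonneg_left zero_le_one)
      rw [← Real.rpow_natCast]
      refine Real.rpow_le_rpow_of_exponent_le h1 ?_
      push_cast
      linarith
  have hbi : Integrable (fun ω => a ^ (2 * N) * (1 + |f ω| ^ (8 * q) / a ^ (4 * q))) μ :=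
    ((integrable_const _).add (hi.div_const _)).const_mul _
  have hint : Integrable (fun ω => f ω ^ (2 * (2 * N))) μ :=
    hbi.mono' (hf.pow_const _).aestronglyMeasurable (Filter.Eventually.of_forall fun ω => by
      rw [Real.norm_of_nonneg (by rw [pow_mul]; positivity)]
      exact hpt ω)
  refine ⟨hint, (integral_mono hint hbi hpt).trans ?_⟩
  rw [integral_const_mul, integral_add (integrable_const _) (hi.div_const _), integral_div]
  simp only [integral_const, probReal_univ, one_smul]
  calc _ ≤ a ^ (2 * N) * (1 + 1) := by
        gcongr
        exact div_le_one_of_le₀ hI (by positivity)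
    _ = _ := by ring

/-- Moments of a linear form of the covariates, in terms of the Euclidean length of the vector. -/
theorem integral_dotProduct_pow_le {p : ℕ} {P : Measure ((Fin p → ℝ) × ℝ)} {CX : ℝ} (hCX : 0 < CX)
    (hψ : covariatePsi2Norm P ≤ ENNReal.ofReal CX) (θ : Fin p → ℝ) {k : ℕ} (hk : k ≠ 0) :
    Integrable (fun z => (z.1 ⬝ᵥ θ) ^ (2 * k)) P ∧
      ∫ z, (z.1 ⬝ᵥ θ) ^ (2 * k) ∂P ≤
        2 * k.factorial * (2 * CX) ^ (2 * k) * (θ ⬝ᵥ θ) ^ k := by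
  rcases eq_or_ne θ 0 with rfl | hθ
  · simp [hk]
  set v : EuclideanSpace ℝ (Fin p) := WithLp.toLp 2 θ with hv
  have hv0 : v ≠ 0 := fun h0 => hθ (congrArg WithLp.ofLp h0)
  have hr : (0 : ℝ) < ‖v‖ := norm_pos_iff.2 hv0
  have hunit := normalize_dotProduct_self hv0
  set u : Fin p → ℝ := (‖v‖⁻¹ • v).ofLp with hu
  have e : ∀ z : (Fin p → ℝ) × ℝ, (z.1 ⬝ᵥ θ) ^ (2 * k) = (‖v‖ ^ 2) ^ k * (z.1 ⬝ᵥ u) ^ (2 * k) := by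
    intro z
    have h1 : θ = ‖v‖ • u := by
      rw [hu, WithLp.ofLp_smul, smul_smul, mul_inv_cancel₀ hr.ne', one_smul]
    conv_lhs => rw [h1, dotProduct_smul, smul_eq_mul, mul_pow, pow_mul]
  obtain ⟨h1, h2⟩ := exp_sq_moment_direction hCX hψ hunit
  obtain ⟨h3, h4⟩ := integral_pow_le_of_integral_exp_sq_le (measurable_fst_dotProduct u)
    (by positivity : 0 < 2 * CX) h1 h2 k
  simp only [e]
  refine ⟨h3.const_mul _, ?_⟩
  rw [integral_const_mul, EuclideanSpace.norm_sq_eq_dotProduct]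
  have h0 : 0 ≤ θ ⬝ᵥ θ := Finset.sum_nonneg fun j _ => mul_self_nonneg (θ j)
  calc (θ ⬝ᵥ θ) ^ k * ∫ z, (z.1 ⬝ᵥ u) ^ (2 * k) ∂P
      ≤ (θ ⬝ᵥ θ) ^ k * (2 * k.factorial * (2 * CX) ^ (2 * k)) := by gcongr
    _ = _ := by ring

/-- In the linear model the regression error for an observation pattern is `ε + Xᵀθ` with the
unexplained direction `θ`; it is uncorrelated with the observed covariates, has variance
`patternVar` and its higher moments are controlled by this variance. -/
theorem IsLinearModel.exists_errorMoments {p : ℕ} {P : Measure ((Fin p → ℝ) × ℝ)} {β : Fin p → ℝ}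
    {σ : ℝ} (h : IsLinearModel P β σ) (hσ : 0 < σ) {CX lam q κ : ℝ} {N : ℕ} (hN : 1 ≤ N)
    (hCX : 0 < CX) (hψ : covariatePsi2Norm P ≤ ENNReal.ofReal CX) (hlam : 0 < lam)
    (hS : ∀ u : Fin p → ℝ, lam * (u ⬝ᵥ u) ≤ u ⬝ᵥ (secondMoment P *ᵥ u)) (hq : 0 < q)
    (hNq : (N : ℝ) ≤ 2 * q) (hκ : 0 < κ) (hi : Integrable (fun z => |noise β z| ^ (8 * q)) P)
    (hmom : (∫ z, |noise β z| ^ (8 * q) ∂P) ^ (1 / (4 * q)) ≤ κ * σ ^ 2) (O : Finset (Fin p)) :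
    ∃ φ : {i // i ∈ O} → ℝ, ErrorMoments (observedLaw P O) φ
      (patternVar (secondMoment P) β σ O)
      (2 ^ (2 * (2 * N)) * (2 * κ ^ (2 * N) +
        2 * (2 * N).factorial * (2 * CX) ^ (2 * (2 * N)) / lam ^ (2 * N)) + 1) N := by
  have := h.isProb
  obtain ⟨θ, hθM, hθO, hθS⟩ := exists_unexplained_direction hlam hS O β
  set d := patternVar (secondMoment P) β σ O with hd
  have hdθ : d = σ ^ 2 + θ ⬝ᵥ (secondMoment P *ᵥ θ) := by rw [hθS]; rfl
  have hθ0 : 0 ≤ θ ⬝ᵥ θ := Finset.sum_nonneg fun j _ => mul_self_nonneg (θ j)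
  have hSθ := hS θ
  have hσ2 : 0 < σ ^ 2 := by positivity
  have hσd : σ ^ 2 ≤ d := by nlinarith
  have hd0 : 0 < d := hσ2.trans_le hσd
  have hθd : θ ⬝ᵥ θ ≤ d / lam := by
    rw [le_div_iff₀ hlam]
    linarith
  set φ : {i // i ∈ O} → ℝ := fun i => β i - θ i with hφ
  have herr : ∀ z : (Fin p → ℝ) × ℝ,
      (observe O z).2 - (observe O z).1 ⬝ᵥ φ = noise β z + z.1 ⬝ᵥ θ := fun z => by
    have h1 : extendZero φ = β - θ := by
      ext i
      by_cases hiO : i ∈ O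
      · simp [extendZero, hiO, hφ]
      · simp [extendZero, hiO, hθM i hiO]
    have h2 : (observe O z).1 ⬝ᵥ φ = z.1 ⬝ᵥ (β - θ) := by
      rw [← h1, dotProduct_extendZero]; rfl
    have h3 : (observe O z).2 = z.2 := rfl
    rw [h2, h3, dotProduct_sub, noise]
    ring
  have hem := ErrorMoments.measurable_error φ
  obtain ⟨hε1, hε2⟩ := integral_pow_le_of_rpow_moment (measurable_noise β) hq hNq
    (by positivity) hi hmom
  obtain ⟨hx1, hx2⟩ := integral_dotProduct_pow_le hCX hψ θ (k := 2 * N) (by omega)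
  have hpt : ∀ z : (Fin p → ℝ) × ℝ, (noise β z + z.1 ⬝ᵥ θ) ^ (2 * (2 * N)) ≤
      2 ^ (2 * (2 * N)) * (noise β z ^ (2 * (2 * N)) + (z.1 ⬝ᵥ θ) ^ (2 * (2 * N))) := fun z => by
    refine (Even.add_pow_le (even_two_mul _)).trans ?_
    have h1 : 0 ≤ noise β z ^ (2 * (2 * N)) := by rw [pow_mul]; positivity
    have h2 : 0 ≤ (z.1 ⬝ᵥ θ) ^ (2 * (2 * N)) := by rw [pow_mul]; positivity
    gcongr
    · norm_num
    · omega
  have hbi : Integrable (fun z : (Fin p → ℝ) × ℝ =>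
      2 ^ (2 * (2 * N)) * (noise β z ^ (2 * (2 * N)) + (z.1 ⬝ᵥ θ) ^ (2 * (2 * N)))) P :=
    (hε1.add hx1).const_mul _
  have hint : Integrable (fun z : (Fin p → ℝ) × ℝ => (noise β z + z.1 ⬝ᵥ θ) ^ (2 * (2 * N))) P :=
    hbi.mono' (((measurable_noise β).add (measurable_fst_dotProduct θ)).pow_const
      _).aestronglyMeasurable (Filter.Eventually.of_forall fun z => by
        rw [Real.norm_of_nonneg (by rw [pow_mul]; positivity)]
        exact hpt z)
  refine ⟨φ, hd0, ?_, fun j => ?_, ?_, ?_⟩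
  · rw [integrable_observedLaw P O (hem.pow_const _)]
    simpa only [herr] using hint
  · rw [integral_observedLaw P O (by fun_prop)]
    simp only [herr]
    have e : ∀ z : (Fin p → ℝ) × ℝ, (observe O z).1 j * (noise β z + z.1 ⬝ᵥ θ) =
        z.1 j * noise β z + z.1 j * (z.1 ⬝ᵥ θ) := fun z => mul_add _ _ _
    simp only [e]
    rw [integral_add (h.integrable_noise_mul j) (h.integrable_mul_dotProduct θ j),
      h.integral_covariate_mul_noise, h.integral_mul_dotProduct, hθO j j.2, add_zero]
  · rw [integral_observedLaw P O (hem.pow_const _)]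
    simp only [herr]
    rw [h.integral_noise_add_sq, ← hdθ]
  · rw [integral_observedLaw P O (hem.pow_const _)]
    simp only [herr]
    have h1 := integral_mono hint hbi hpt
    rw [integral_const_mul, integral_add hε1 hx1] at h1
    calc _ ≤ _ := h1
      _ ≤ 2 ^ (2 * (2 * N)) * (2 * (κ * d) ^ (2 * N) +
          2 * (2 * N).factorial * (2 * CX) ^ (2 * (2 * N)) * (d / lam) ^ (2 * N)) := by
        gcongr
        · exact hε2.trans (by gcongr)
        · exact hx2.trans (by gcongr)
      _ = 2 ^ (2 * (2 * N)) * (2 * κ ^ (2 * N) +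
          2 * (2 * N).factorial * (2 * CX) ^ (2 * (2 * N)) / lam ^ (2 * N)) * d ^ (2 * N) := by
        rw [mul_pow, div_pow]
        ring
      _ ≤ _ := by
        gcongr
        linarith

end BlockMissing

/-! ### From concentration to moments of the weight ratios -/

namespace BlockMissing

/-! Since `κL ≤ d ≤ κU`, clipping changes neither ratio by more than a factor `2 κU / κL`, and it
keeps values within a factor two of `d` within a factor two. -/

section Clip

variable {κL κU d r : ℝ}

theorem clipVar_pos (hL : 0 < κL) (hU : 0 < κU) : 0 < clipVar κL κU r := by
  unfold clipVar
  split_ifs <;> linarith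

theorem clipVar_bounds (hL : 0 < κL) (hLd : κL ≤ d) (hdU : d ≤ κU) :
    κL / 2 ≤ clipVar κL κU r ∧ clipVar κL κU r ≤ 2 * κU := by
  unfold clipVar
  split_ifs <;> constructor <;> linarith

theorem le_two_mul_clipVar (hL : 0 < κL) (hLd : κL ≤ d) (hdU : d ≤ κU) (hr : d / 2 ≤ r) :
    d ≤ 2 * clipVar κL κU r := by
  unfold clipVar
  split_ifs <;> linarith

theorem clipVar_le_two_mul (hL : 0 < κL) (hLd : κL ≤ d) (hr : r ≤ 2 * d) :
    clipVar κL κU r ≤ 2 * d := by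
  unfold clipVar
  split_ifs <;> linarith

theorem div_clipVar_le (hL : 0 < κL) (hLd : κL ≤ d) (hdU : d ≤ κU) :
    d / clipVar κL κU r ≤ 2 * (κU / κL) := by
  have hb := (clipVar_bounds (r := r) hL hLd hdU).1
  rw [div_le_iff₀ (by linarith)]
  have hR : 0 ≤ κU / κL := div_nonneg (by linarith) hL.le
  calc d ≤ 2 * (κU / κL) * (κL / 2) := by
        rw [show 2 * (κU / κL) * (κL / 2) = κU by field_simp]
        exact hdU
    _ ≤ _ := by gcongr

theorem clipVar_div_le (hL : 0 < κL) (hLd : κL ≤ d) (hdU : d ≤ κU) :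
    clipVar κL κU r / d ≤ 2 * (κU / κL) := by
  have hb := (clipVar_bounds (r := r) hL hLd hdU).2
  rw [div_le_iff₀ (by linarith)]
  have hR : 0 ≤ κU / κL := div_nonneg (by linarith) hL.le
  calc _ ≤ 2 * κU := hb
    _ = 2 * (κU / κL) * κL := by field_simp
    _ ≤ _ := by gcongr

theorem measurable_clipVar (κL κU : ℝ) : Measurable (clipVar κL κU) :=
  Measurable.ite measurableSet_Iic measurable_const
    (Measurable.ite measurableSet_Iio measurable_id measurable_const)

end Clip

/-- A bounded variable that is at most `2` off a rare event has a controlled power mean. -/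
theorem integral_pow_le_of_le_two_off {Ω : Type*} [MeasurableSpace Ω] {μ : Measure Ω}
    [IsProbabilityMeasure μ] {g : Ω → ℝ} (hg : Measurable g) {E : Set Ω} (hE : MeasurableSet E)
    {R : ℝ} (h0 : ∀ ω, 0 ≤ g ω) (hgR : ∀ ω, g ω ≤ 2 * R) (hg2 : ∀ ω, ω ∉ E → g ω ≤ 2)
    (k : ℕ) (hrare : R ^ k * μ.real E ≤ 1) :
    Integrable (fun ω => g ω ^ k) μ ∧ ∫ ω, g ω ^ k ∂μ ≤ 2 * 2 ^ k := by
  have hpt : ∀ ω, g ω ^ k ≤ 2 ^ k + E.indicator (fun _ => (2 * R) ^ k) ω := fun ω => by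
    by_cases hω : ω ∈ E
    · rw [Set.indicator_of_mem hω]
      exact (pow_le_pow_left₀ (h0 ω) (hgR ω) k).trans (le_add_of_nonneg_left (by positivity))
    · rw [Set.indicator_of_notMem hω, add_zero]
      exact pow_le_pow_left₀ (h0 ω) (hg2 ω hω) k
  have hind : Integrable (E.indicator fun _ => (2 * R) ^ k) μ := (integrable_const _).indicator hE
  have hbi : Integrable (fun ω => 2 ^ k + E.indicator (fun _ => (2 * R) ^ k) ω) μ :=
    (integrable_const _).add hind
  have hint : Integrable (fun ω => g ω ^ k) μ :=
    hbi.mono' (hg.pow_const k).aestronglyMeasurable (Filter.Eventually.of_forall fun ω => by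
      rw [Real.norm_of_nonneg (pow_nonneg (h0 ω) k)]
      exact hpt ω)
  refine ⟨hint, (integral_mono hint hbi hpt).trans ?_⟩
  rw [integral_add (integrable_const _) hind, integral_indicator hE]
  simp only [integral_const, probReal_univ, measureReal_restrict_apply_univ, smul_eq_mul, one_mul]
  calc 2 ^ k + μ.real E * (2 * R) ^ k = 2 ^ k + 2 ^ k * (R ^ k * μ.real E) := by
        rw [mul_pow]; ring
    _ ≤ 2 ^ k + 2 ^ k * 1 := by gcongr
    _ = _ := by ring

/-- The two weight ratios for pattern `k`, given that the residual variance of this pattern is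
rarely off by more than a factor two. -/
theorem weight_ratio_moments {p K : ℕ} (P : Measure ((Fin p → ℝ) × ℝ)) [IsProbabilityMeasure P]
    (O : Fin K → Finset (Fin p)) (n : Fin K → ℕ) (k : Fin K) {S : Matrix (Fin p) (Fin p) ℝ}
    {β : Fin p → ℝ} {σ κL κU : ℝ} (hσ : 0 < σ) (hL : 0 < κL)
    (hLd : κL ≤ patternVar S β σ (O k)) (hdU : patternVar S β σ (O k) ≤ κU) (N : ℕ)
    (hrare : (κU / κL) ^ N * (Measure.pi fun _ : Fin (n k) => observedLaw P (O k)).real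
      {D : PatternData (O k) (n k) | ¬ (patternVar S β σ (O k) / 2 ≤ residualVar D ∧
        residualVar D ≤ 2 * patternVar S β σ (O k))} ≤ 1) :
    (Integrable (fun D : ∀ k, PatternData (O k) (n k) =>
        (estWeight σ κL κU (D k) / oracleWeight S β σ (O k)) ^ N) (labelledLaw P O n) ∧
      ∫ D, (estWeight σ κL κU (D k) / oracleWeight S β σ (O k)) ^ N ∂(labelledLaw P O n) ≤
        2 * 2 ^ N) ∧
    (Integrable (fun D : ∀ k, PatternData (O k) (n k) =>
        (oracleWeight S β σ (O k) / estWeight σ κL κU (D k)) ^ N) (labelledLaw P O n) ∧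
      ∫ D, (oracleWeight S β σ (O k) / estWeight σ κL κU (D k)) ^ N ∂(labelledLaw P O n) ≤
        2 * 2 ^ N) := by
  have := fun k => isProbabilityMeasure_observedLaw P (O k)
  set d := patternVar S β σ (O k) with hd
  have hd0 : 0 < d := hL.trans_le hLd
  have hU : 0 < κU := hd0.trans_le hdU
  have hmp : MeasurePreserving (Function.eval k) (labelledLaw P O n)
      (Measure.pi fun _ : Fin (n k) => observedLaw P (O k)) :=
    measurePreserving_eval
      (fun k => Measure.pi fun _ : Fin (n k) => observedLaw P (O k)) k
  have : IsProbabilityMeasure (labelledLaw P O n) :=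
    inferInstanceAs (IsProbabilityMeasure (Measure.pi fun k =>
      Measure.pi fun _ : Fin (n k) => observedLaw P (O k)))
  set E₀ : Set (PatternData (O k) (n k)) :=
    {D | ¬ (d / 2 ≤ residualVar D ∧ residualVar D ≤ 2 * d)} with hE₀
  have hE₀m : MeasurableSet E₀ :=
    ((measurableSet_le measurable_const measurable_residualVar).inter
      (measurableSet_le measurable_residualVar measurable_const)).compl
  have hclip : Measurable fun D : ∀ k, PatternData (O k) (n k) =>
      clipVar κL κU (residualVar (D k)) :=
    (measurable_clipVar κL κU).comp (measurable_residualVar.comp (measurable_pi_apply k))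
  have hrare' : (κU / κL) ^ N * (labelledLaw P O n).real (Function.eval k ⁻¹' E₀) ≤ 1 := by
    rwa [hmp.measureReal_preimage hE₀m.nullMeasurableSet]
  have hE := hmp.measurable hE₀m
  have hgood : ∀ D : ∀ k, PatternData (O k) (n k), D ∉ Function.eval k ⁻¹' E₀ →
      d / 2 ≤ residualVar (D k) ∧ residualVar (D k) ≤ 2 * d := fun D hD => not_not.1 hD
  have e1 : ∀ D : PatternData (O k) (n k), estWeight σ κL κU D / oracleWeight S β σ (O k) =
      d / clipVar κL κU (residualVar D) := fun D => by
    have := (clipVar_pos (r := residualVar D) hL hU).ne'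
    rw [estWeight, oracleWeight, ← hd]
    field_simp
  have e2 : ∀ D : PatternData (O k) (n k), oracleWeight S β σ (O k) / estWeight σ κL κU D =
      clipVar κL κU (residualVar D) / d := fun D => by
    rw [← inv_div, e1, inv_div]
  simp only [e1, e2]
  refine ⟨integral_pow_le_of_le_two_off (measurable_const.div hclip) hE
    (fun D => div_nonneg hd0.le (clipVar_pos hL hU).le)
    (fun D => div_clipVar_le hL hLd hdU) (fun D hD => ?_) N hrare',
    integral_pow_le_of_le_two_off (hclip.div_const d) hE
    (fun D => div_nonneg (clipVar_pos hL hU).le hd0.le)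
    (fun D => clipVar_div_le hL hLd hdU) (fun D hD => ?_) N hrare'⟩
  · change d / clipVar κL κU (residualVar (D k)) ≤ 2
    rw [div_le_iff₀ (clipVar_pos hL hU)]
    exact le_two_mul_clipVar hL hLd hdU (hgood D hD).1
  · rw [div_le_iff₀ hd0]
    exact clipVar_le_two_mul hL hLd (hgood D hD).2

end BlockMissing

theorem mainTheorem2 :
    -- a universal constant
    ∃ H : ℝ,
      ∀ (lamMin lamMax C χ q CX κε : ℝ),
        0 < lamMin → lamMin ≤ lamMax → 1 ≤ C → 0 < χ → χ ≤ 1 → 1 ≤ q → 0 < CX →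
        -- a constant that depends only on the parameters above
        ∃ F : ℝ, 0 < F ∧
          ∀ (p K : ℕ) (O : Fin K → Finset (Fin p)) (n : Fin K → ℕ)
            (P : Measure ((Fin p → ℝ) × ℝ)) (β : Fin p → ℝ) (σ κL κU : ℝ),
            (∀ k, (O k).Nonempty) →
            0 < σ → 0 < κL → 0 < κU →
            BlockMissing.IsLinearModel P β σ →
            BlockMissing.SmallBall P C χ →
            BlockMissing.covariatePsi2Norm P ≤ ENNReal.ofReal CX →
            spectrum ℝ (BlockMissing.secondMoment P) ⊆ Set.Icc lamMin lamMax →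
            Integrable (fun z => |BlockMissing.noise β z| ^ (8 * q)) P →
            (∫ z, |BlockMissing.noise β z| ^ (8 * q) ∂P) ^ (1 / (4 * q)) ≤ κε * σ ^ 2 →
            (∀ k, κL ≤ BlockMissing.patternVar (BlockMissing.secondMoment P) β σ (O k) ∧
              BlockMissing.patternVar (BlockMissing.secondMoment P) β σ (O k) ≤ κU) →
            (∀ k, (24 * q + 6 * ((O k).card : ℝ)) / χ ≤ (n k : ℝ)) →
            (∀ k, (((O k).card : ℝ) / (n k : ℝ)) ^ q * (κU / κL) ^ 16 ≤ 1 / F) →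
            ∀ k,
              Integrable (fun D : ∀ k, BlockMissing.PatternData (O k) (n k) =>
                (BlockMissing.estWeight σ κL κU (D k) /
                  BlockMissing.oracleWeight (BlockMissing.secondMoment P) β σ (O k)) ^ 16)
                (BlockMissing.labelledLaw P O n) ∧
              Integrable (fun D : ∀ k, BlockMissing.PatternData (O k) (n k) =>
                (BlockMissing.oracleWeight (BlockMissing.secondMoment P) β σ (O k) /
                  BlockMissing.estWeight σ κL κU (D k)) ^ 16)
                (BlockMissing.labelledLaw P O n) ∧
              (∫ D, (BlockMissing.estWeight σ κL κU (D k) /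
                  BlockMissing.oracleWeight (BlockMissing.secondMoment P) β σ (O k)) ^ 16
                  ∂(BlockMissing.labelledLaw P O n)) +
                (∫ D, (BlockMissing.oracleWeight (BlockMissing.secondMoment P) β σ (O k) /
                  BlockMissing.estWeight σ κL κU (D k)) ^ 16
                  ∂(BlockMissing.labelledLaw P O n)) ≤ H := by
  refine ⟨2 ^ 18, fun lamMin lamMax C χ q CX κε hlam _ hC hχ _ hq hCX => ?_⟩
  -- an integer `N` with `q ≤ N ≤ 2 q`: moments of order `4 N ≤ 8 q` exist, and `(|O| / n) ^ N` is
  -- at most `(|O| / n) ^ q`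
  set N := ⌈q⌉₊ with hN
  have hq0 : 0 < q := by linarith
  have hC0 : 0 < C := by linarith
  have hqN : q ≤ N := Nat.le_ceil q
  have hN1 : 1 ≤ N := Nat.one_le_iff_ne_zero.2 (Nat.ceil_pos.2 hq0).ne'
  have hN2 : (N : ℝ) ≤ 2 * q := by
    have := Nat.ceil_lt_add_one hq0.le
    linarith
  set κ := max κε 1 with hκ
  have hκ0 : 0 < κ := lt_of_lt_of_le one_pos (le_max_right _ _)
  set M : ℝ := 2 ^ (2 * (2 * N)) * (2 * κ ^ (2 * N) +
    2 * (2 * N).factorial * (2 * CX) ^ (2 * (2 * N)) / lamMin ^ (2 * N)) + 1 with hM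
  have hM1 : 1 ≤ M := le_add_of_nonneg_left (by positivity)
  obtain ⟨A, F₀, hA, hF₀, hdev⟩ := BlockMissing.exists_residualVar_deviation_bound
    (c := 2 * CX) (s := (1 / 60) ^ (1 / χ) / C * √lamMin) (by positivity) (by positivity) hM1 hN1
  have hA0 : 0 < A := by linarith
  -- `A ^ q` makes the last hypothesis imply `A |O| ≤ n`, and `F₀` absorbs the deviation probability
  refine ⟨A ^ q + F₀, by positivity, ?_⟩
  intro p K O n P β σ κL κU hO hσ hL _ hmodel hball hψ hspec hint hmom hκd hn hsize k
  have := hmodel.isProb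
  have hS := (BlockMissing.secondMoment_isHermitian P).mul_dotProduct_le_of_spectrum hspec
  obtain ⟨hLd, hdU⟩ := hκd k
  have hm1 : (1 : ℝ) ≤ (O k).card := by exact_mod_cast (hO k).card_pos
  have hn0 : (0 : ℝ) < n k := lt_of_lt_of_le (by positivity) (hn k)
  have hR1 : 1 ≤ κU / κL := by
    rw [le_div_iff₀ hL]
    linarith
  set x : ℝ := ((O k).card : ℝ) / n k with hx
  have hx0 : 0 < x := by positivity
  have hsz := hsize k
  have hF1 : x ^ q ≤ 1 / (A ^ q + F₀) :=
    (le_mul_of_one_le_right (by positivity) (one_le_pow₀ hR1)).trans hsz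
  have hAx : A * x ≤ 1 := by
    have h1 : (A * x) ^ q ≤ 1 ^ q := by
      rw [Real.mul_rpow hA0.le hx0.le, Real.one_rpow]
      calc A ^ q * x ^ q ≤ A ^ q * (1 / (A ^ q + F₀)) := by gcongr
        _ ≤ 1 := by
          rw [mul_one_div]
          exact div_le_one_of_le₀ (by linarith) (by positivity)
    exact (Real.rpow_le_rpow_iff (by positivity) zero_le_one hq0).1 h1
  have hAn : A * (O k).card ≤ n k := by
    rw [hx, ← mul_div_assoc, div_le_one hn0] at hAx
    exact hAx
  have hx1 : x ≤ 1 := (le_mul_of_one_le_left hx0.le hA).trans hAx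
  have hxN : x ^ N ≤ x ^ q := by
    rw [← Real.rpow_natCast]
    exact Real.rpow_le_rpow_of_exponent_ge hx0 hx1 hqN
  have hdir := BlockMissing.directionBounds_observedLaw hCX hC0 hχ hψ hball hS (O k)
  obtain ⟨φ, hφ⟩ := hmodel.exists_errorMoments hσ hN1 hCX hψ hlam hS hq0 hN2 hκ0 hint
    (hmom.trans (by gcongr; exact le_max_left _ _)) (O k)
  have hprob := BlockMissing.isProbabilityMeasure_observedLaw P (O k)
  have hbad := hdev p (n k) (O k) (BlockMissing.observedLaw P (O k)) φ _ (hO k)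
    (by exact_mod_cast hn0) hAn hdir hφ
  have hrare : (κU / κL) ^ 16 * (F₀ * x ^ N) ≤ 1 := by
    calc (κU / κL) ^ 16 * (F₀ * x ^ N) ≤ (κU / κL) ^ 16 * (F₀ * x ^ q) := by gcongr
      _ = F₀ * (x ^ q * (κU / κL) ^ 16) := by ring
      _ ≤ F₀ * (1 / (A ^ q + F₀)) := by gcongr
      _ ≤ 1 := by
        rw [mul_one_div]
        have : 0 < A ^ q := by positivity
        exact div_le_one_of_le₀ (by linarith) (by positivity)
  obtain ⟨⟨i1, b1⟩, i2, b2⟩ := BlockMissing.weight_ratio_moments P O n k hσ hL hLd hdU 16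
    ((mul_le_mul_of_nonneg_left hbad (by positivity)).trans hrare)
  exact ⟨i1, i2, (add_le_add b1 b2).trans (by norm_num)⟩
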